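/- Throughout, partitions are identified with their (ordinary) Young diagrams, and strict partitions $\lambda=(\lambda_1>\dots>\lambda_\ell>0)$, $\ell=\ell(\lambda)$, with their shifted Young diagrams (row $i$ occupies columns $i,\dots,i+\lambda_i-1$). The content of a box is its column number minus its row number. Write $\sigma\nearrow\rho$ (resp. $\mu\Nearrow\lambda$) if the ordinary (resp. shifted) diagram $\rho$ (resp. $\lambda$) is obtained from $\sigma$ (resp. $\mu$) by adding one box. Let $f_\rho$ (resp. $g_\lambda$) be the number of paths from $\varnothing$ to $\rho$ along $\nearrow$ (resp. from $\varnothing$ to $\lambda$ along $\Nearrow$). The Plancherel measures are $\mathrm{Pl}_n(\rho)=f_\rho^2/n!$ on partitions $\rho$ of $n$ and $\mathbb{Pl}_n(\lambda)=2^{n-\ell(\lambda)}g_\lambda^2/n!$ on strict partitions $\lambda$ of $n$. The corresponding up transition probabilities are $$p^\uparrow_{\mathrm{Pl}}(\sigma,\rho)=\frac{f_\sigma}{f_\rho}\cdot\frac{\mathrm{Pl}_{n+1}(\rho)}{\mathrm{Pl}_n(\sigma)}\quad(\sigma\nearrow\rho,\ |\sigma|=n),\qquad p^\Uparrow_{\mathbb{Pl}}(\mu,\lambda)=\frac{g_\mu}{g_\lambda}\cdot\frac{\mathbb{Pl}_{n+1}(\lambda)}{\mathbb{Pl}_n(\mu)}\quad(\mu\Nearrow\lambda,\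 |\mu|=n),$$ and $0$ for all other pairs. The doubling $\mathcal{D}\lambda$ of a strict partition $\lambda$ is the partition of $2|\lambda|$ with Frobenius coordinates $(\lambda_1,\dots,\lambda_\ell\mid\lambda_1-1,\dots,\lambda_\ell-1)$. For an ordinary diagram $\rho$ put $$\mathcal{R}^\uparrow(u;\rho)=\frac{\prod_{y}(u-y)}{\prod_{x}(u-x)},$$ where $y$ (resp. $x$) runs over the contents of the boxes that can be removed from (resp. added to) $\rho$. For a strict partition $\lambda$ put $$\mathcal{R}^\Uparrow(v;\lambda)=\frac{\prod_{y}(v-y(y+1))}{v\prod_{x}(v-x(x+1))},$$ where $y$ runs over the contents of the boxes that can be removed from the shifted diagram $\lambda$, and $x$ over the nonzero contents of the boxes that can be added to it. **Proposition.** (1) For every strict partition $\lambda$, one has the identity of rational functions in $u$ over $\mathbb{C}$ $$(u-1)\cdot\mathcal{R}^\Uparrow(u(u-1);\lambda)=\mathcal{R}^\uparrow(u;\mathcal{D}\lambda).$$ (2) Let $\mu\Nearrow\lambda$ be strict partitions. If $\ell(\lambda)=\ell(\mu)$, then there are exactly two ordinary diagrams $\rho^{(a)}\neq\rho^{(b)}$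 with $\mathcal{D}\mu\nearrow\rho^{(a)},\rho^{(b)}\nearrow\mathcal{D}\lambda$, and $$p^\Uparrow_{\mathbb{Pl}}(\mu,\lambda)=p^\uparrow_{\mathrm{Pl}}(\mathcal{D}\mu,\rho^{(a)})+p^\uparrow_{\mathrm{Pl}}(\mathcal{D}\mu,\rho^{(b)}).$$ Otherwise $\ell(\lambda)=\ell(\mu)+1$, there is exactly one ordinary diagram $\rho$ with $\mathcal{D}\mu\nearrow\rho\nearrow\mathcal{D}\lambda$, and $$p^\Uparrow_{\mathbb{Pl}}(\mu,\lambda)=p^\uparrow_{\mathrm{Pl}}(\mathcal{D}\mu,\rho).$$ -/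

import Mathlib

/-! ### Graded graphs: paths, down and up transition probabilities -/

/-- Directed paths `a → ⋯ → b` along the edge relation `E`. -/
inductive GraphPath {V : Type} (E : V → V → Prop) (a : V) : V → Type
  | nil : GraphPath E a a
  | snoc {b c : V} (p : GraphPath E a b) (h : E b c) : GraphPath E a c

/-- The number of directed paths from `a` to `b`. -/
noncomputable def numPaths {V : Type} (E : V → V → Prop) (a b : V) : ℕ :=
  Nat.card (GraphPath E a b)

open Classical in
/-- Down transition probability from `y` to `x` on a graph with edges `E` and initial vertex
`root`: the ratio `dim x / dim y` if `x` is joined to `y` by an edge going up from `x` to `y`,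
and `0` otherwise; here `dim` is the number of paths from `root`. -/
noncomputable def downProb {V : Type} (E : V → V → Prop) (root : V) (y x : V) : ℝ :=
  if E x y then (numPaths E root x : ℝ) / (numPaths E root y : ℝ) else 0

open Classical in
/-- Up transition probability from `x` to `y` of a system of measures on the levels of the graph.
The system `(Mₙ)` is given by the single function `M` on vertices, `M v = M_{|v|}({v})`. -/
noncomputable def upProb {V : Type} (E : V → V → Prop) (root : V) (M : V → ℝ) (x y : V) : ℝ :=
  if E x y then downProb E root y x * M y / M x else 0

/-- The content (column minus row) of a box `(row, column)`. -/
def boxContent (b : ℕ × ℕ) : ℤ := (b.2 : ℤ) - (b.1 : ℤ)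

/-! ### The Young graph -/

/-- `σ ↗ ρ`: the diagram `ρ` is obtained from `σ` by adding one box. -/
def YoungDiagram.Covers (σ ρ : YoungDiagram) : Prop :=
  σ ≤ ρ ∧ ρ.card = σ.card + 1

/-- The number `f_ρ` of paths from `∅` to `ρ` in the Young graph. -/
noncomputable def YoungDiagram.dim (ρ : YoungDiagram) : ℕ :=
  numPaths YoungDiagram.Covers ⊥ ρ

/-- The Plancherel measure `Plₙ(ρ) = f_ρ² / n!`, `n = |ρ|`. -/
noncomputable def YoungDiagram.plancherel (ρ : YoungDiagram) : ℝ :=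
  (ρ.dim : ℝ) ^ 2 / (ρ.card.factorial : ℝ)

/-- The Plancherel up transition probabilities on the Young graph. -/
noncomputable def YoungDiagram.plancherelUp (σ ρ : YoungDiagram) : ℝ :=
  upProb YoungDiagram.Covers ⊥ YoungDiagram.plancherel σ ρ

/-- Boxes that can be added to `ρ`. -/
def YoungDiagram.addable (ρ : YoungDiagram) : Set (ℕ × ℕ) :=
  {b | ∃ ρ' : YoungDiagram, ρ.Covers ρ' ∧ b ∈ ρ' ∧ b ∉ ρ}

/-- Boxes that can be removed from `ρ`. -/
def YoungDiagram.removable (ρ : YoungDiagram) : Set (ℕ × ℕ) :=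
  {b | ∃ σ : YoungDiagram, σ.Covers ρ ∧ b ∈ ρ ∧ b ∉ σ}

theorem YoungDiagram.addable_finite (ρ : YoungDiagram) : ρ.addable.Finite := by
  have key : ∀ b ∈ ρ.addable, ∀ c : ℕ × ℕ, c ≤ b → c ≠ b → c ∈ ρ := by
    rintro b ⟨ρ', ⟨hle, hcard⟩, hb, hb'⟩ c hc hne
    have hc' : c ∈ ρ' := ρ'.isLowerSet hc hb
    by_contra hcρ
    have hsub : insert b (insert c ρ.cells) ⊆ ρ'.cells := by
      intro x hx
      simp only [Finset.mem_insert] at hx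
      rcases hx with rfl | rfl | hx
      · exact hb
      · exact hc'
      · exact YoungDiagram.cells_subset_iff.2 hle hx
    have h1 := Finset.card_le_card hsub
    rw [Finset.card_insert_of_notMem, Finset.card_insert_of_notMem] at h1
    · change ρ.card + 1 + 1 ≤ ρ'.card at h1
      omega
    · exact hcρ
    · simp only [Finset.mem_insert, not_or]
      exact ⟨fun h => hne h.symm, hb'⟩
  refine (Set.finite_Iic (ρ.colLen 0, ρ.rowLen 0)).subset ?_
  rintro ⟨i, j⟩ hb
  refine ⟨?_, ?_⟩
  · by_contra h
    have h' : ρ.colLen 0 < i := not_le.1 h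
    have := key _ hb (ρ.colLen 0, 0) ⟨h'.le, Nat.zero_le _⟩
      (fun e => h'.ne (congrArg Prod.fst e))
    rw [YoungDiagram.mem_iff_lt_colLen] at this
    exact lt_irrefl _ this
  · by_contra h
    have h' : ρ.rowLen 0 < j := not_le.1 h
    have := key _ hb (0, ρ.rowLen 0) ⟨Nat.zero_le _, h'.le⟩
      (fun e => h'.ne (congrArg Prod.snd e))
    rw [YoungDiagram.mem_iff_lt_rowLen] at this
    exact lt_irrefl _ this

theorem YoungDiagram.removable_finite (ρ : YoungDiagram) : ρ.removable.Finite :=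
  ρ.cells.finite_toSet.subset fun _ ⟨_, _, hb, _⟩ => hb

/-- The rational function `∏ (u - y) / ∏ (u - x)`, where `y` and `x` run over the contents of the
boxes that can be removed from, respectively added to, `ρ`. -/
noncomputable def YoungDiagram.kerovR (ρ : YoungDiagram) : RatFunc ℂ :=
  (∏ b ∈ ρ.removable_finite.toFinset, (RatFunc.X - RatFunc.C (boxContent b : ℂ))) /
    ∏ b ∈ ρ.addable_finite.toFinset, (RatFunc.X - RatFunc.C (boxContent b : ℂ))

/-! ### Strict partitions and the Schur graph -/

/-- A strict partition: a weakly decreasing sequence of nonnegative integers, finitely many of them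
nonzero, whose nonzero members are distinct. Rows are numbered from `0`. -/
@[ext]
structure StrictPartition where
  part : ℕ →₀ ℕ
  antitone : Antitone part
  strict : ∀ i j, part i ≠ 0 → part i = part j → i = j

namespace StrictPartition

/-- The empty partition. -/
def empty : StrictPartition where
  part := 0
  antitone := fun _ _ _ => le_rfl
  strict := fun _ _ h _ => absurd rfl h

/-- The weight `|lam|`. -/
def weight (lam : StrictPartition) : ℕ := ∑ i ∈ lam.part.support, lam.part i

/-- The number `ℓ(lam)` of nonzero parts. -/
def length (lam : StrictPartition) : ℕ := lam.part.support.card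

/-- The boxes of the shifted Young diagram: row `i` occupies the columns
`i, i + 1, …, i + lam_i - 1`. -/
def cells (lam : StrictPartition) : Finset (ℕ × ℕ) :=
  lam.part.support.biUnion fun i => {i} ×ˢ Finset.Ico i (i + lam.part i)

theorem mem_cells (lam : StrictPartition) (i j : ℕ) :
    (i, j) ∈ lam.cells ↔ i ≤ j ∧ j < i + lam.part i := by
  simp only [cells, Finset.mem_biUnion, Finsupp.mem_support_iff, Finset.mem_product,
    Finset.mem_singleton, Finset.mem_Ico]
  constructor
  · rintro ⟨k, _, rfl, h⟩
    exact h
  · rintro h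
    exact ⟨i, by omega, rfl, h⟩

/-- `mu ⇗ lam`: the shifted diagram of `lam` is obtained from that of `mu` by adding one box. -/
def Covers (mu lam : StrictPartition) : Prop :=
  mu.cells ⊆ lam.cells ∧ lam.weight = mu.weight + 1

/-- The number `g_lam` of paths from `∅` to `lam` in the Schur graph. -/
noncomputable def dim (lam : StrictPartition) : ℕ := numPaths Covers empty lam

/-- The Plancherel measure `2^(n - ℓ(lam)) g_lam² / n!`, `n = |lam|`, on strict partitions. -/
noncomputable def plancherel (lam : StrictPartition) : ℝ :=
  (2 : ℝ) ^ ((lam.weight : ℤ) - (lam.length : ℤ)) * (lam.dim : ℝ) ^ 2 /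
    (lam.weight.factorial : ℝ)

/-- The Plancherel up transition probabilities on the Schur graph. -/
noncomputable def plancherelUp (mu lam : StrictPartition) : ℝ :=
  upProb Covers empty plancherel mu lam

/-- Boxes that can be added to the shifted diagram of `lam`. -/
def addable (lam : StrictPartition) : Set (ℕ × ℕ) :=
  {b | ∃ nu : StrictPartition, lam.Covers nu ∧ b ∈ nu.cells ∧ b ∉ lam.cells}

/-- Boxes that can be removed from the shifted diagram of `lam`. -/
def removable (lam : StrictPartition) : Set (ℕ × ℕ) :=
  {b | ∃ mu : StrictPartition, mu.Covers lam ∧ b ∈ lam.cells ∧ b ∉ mu.cells}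

theorem removable_finite (lam : StrictPartition) : lam.removable.Finite :=
  lam.cells.finite_toSet.subset fun _ ⟨_, _, hb, _⟩ => hb

theorem part_succ_lt (lam : StrictPartition) (i : ℕ) (h : lam.part i ≠ 0) :
    lam.part (i + 1) < lam.part i := by
  refine lt_of_le_of_ne (lam.antitone (Nat.le_succ i)) fun e => ?_
  have := lam.strict i (i + 1) h e.symm
  omega

theorem add_part_le (lam : StrictPartition) {i k : ℕ} (hik : i ≤ k) (hk : lam.part k ≠ 0) :
    k + lam.part k ≤ i + lam.part i := by
  induction k, hik using Nat.le_induction with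
  | base => exact le_rfl
  | succ k hik ih =>
    have h0 : lam.part k ≠ 0 := fun h => hk (by
      have := lam.antitone (Nat.le_succ k)
      rw [h] at this
      exact Nat.le_zero.1 this)
    have := lam.part_succ_lt k h0
    have := ih h0
    omega

theorem addable_finite (lam : StrictPartition) : lam.addable.Finite := by
  refine (Set.finite_Iic (lam.weight + 1, lam.weight + 1)).subset ?_
  rintro ⟨i, j⟩ ⟨nu, ⟨_, hw⟩, hb, _⟩
  rw [mem_cells] at hb
  have h1 : nu.part i ≠ 0 := by omega
  have hj : j < 0 + nu.part 0 := lt_of_lt_of_le hb.2 (nu.add_part_le (Nat.zero_le i) h1)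
  have h0 : nu.part 0 ≤ nu.weight := by
    have h00 : nu.part 0 ≠ 0 := by omega
    exact Finset.single_le_sum (f := fun i => nu.part i) (fun _ _ => Nat.zero_le _)
      (Finsupp.mem_support_iff.2 h00)
  exact ⟨by show i ≤ _; omega, by show j ≤ _; omega⟩

open Classical in
/-- The rational function `∏ (v - y (y + 1)) / (v ∏ (v - x (x + 1)))`, where `y` runs over the
contents of the boxes that can be removed from `lam` and `x` runs over the nonzero contents of
the boxes that can be added to `lam`. -/
noncomputable def kerovR (lam : StrictPartition) : RatFunc ℂ :=
  (∏ b ∈ lam.removable_finite.toFinset,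
      (RatFunc.X - RatFunc.C ((boxContent b : ℂ) * ((boxContent b : ℂ) + 1)))) /
    (RatFunc.X * ∏ b ∈ lam.addable_finite.toFinset with boxContent b ≠ 0,
      (RatFunc.X - RatFunc.C ((boxContent b : ℂ) * ((boxContent b : ℂ) + 1))))

/-- The boxes of the diagram with Frobenius coordinates
`(lam_1, …, lam_ℓ | lam_1 - 1, …, lam_ℓ - 1)`: the union over `i` of the hooks with corner `(i, i)`,
arm length `lam_i` and leg length `lam_i - 1`. -/
def doubleCells (lam : StrictPartition) : Finset (ℕ × ℕ) :=
  lam.part.support.biUnion fun i =>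
    ({i} ×ˢ Finset.Icc i (i + lam.part i)) ∪ (Finset.Icc i (i + (lam.part i - 1)) ×ˢ {i})

theorem mem_doubleCells (lam : StrictPartition) (a b : ℕ) :
    (a, b) ∈ lam.doubleCells ↔ lam.part (min a b) ≠ 0 ∧
      a < min a b + lam.part (min a b) ∧ b ≤ min a b + lam.part (min a b) := by
  simp only [doubleCells, Finset.mem_biUnion, Finsupp.mem_support_iff, Finset.mem_union,
    Finset.mem_product, Finset.mem_singleton, Finset.mem_Icc]
  constructor
  · rintro ⟨i, h0, ⟨rfl, h1, h2⟩ | ⟨⟨h1, h2⟩, rfl⟩⟩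
    · rw [min_eq_left h1]
      exact ⟨h0, by omega, h2⟩
    · rw [min_eq_right h1]
      exact ⟨h0, by omega, by omega⟩
  · rintro ⟨h0, h1, h2⟩
    refine ⟨min a b, h0, ?_⟩
    rcases le_total a b with h | h
    · rw [min_eq_left h] at *
      exact Or.inl ⟨rfl, h, h2⟩
    · rw [min_eq_right h] at *
      exact Or.inr ⟨⟨h, by omega⟩, rfl⟩

/-- The doubling `D lam`, an ordinary Young diagram. -/
def double (lam : StrictPartition) : YoungDiagram where
  cells := lam.doubleCells
  isLowerSet := by
    rintro ⟨a, b⟩ ⟨a', b'⟩ ⟨ha, hb⟩ h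
    change a' ≤ a at ha
    change b' ≤ b at hb
    rw [Finset.mem_coe, mem_doubleCells] at h ⊢
    obtain ⟨h0, h1, h2⟩ := h
    have hm : min a' b' ≤ min a b := min_le_min ha hb
    have h3 := lam.add_part_le hm h0
    have h4 := lam.antitone hm
    exact ⟨by omega, by omega, by omega⟩

end StrictPartition

/-! Part (1) rests on a box-by-box description of the rational function. For an ordinary diagram, u
· R(u) is the product over all boxes of (u - c)² / ((u - c - 1)(u - c + 1)), c being the content,
because the product telescopes along each row. The doubling replaces a shifted box of content c by
two boxes of contents c + 1 and -c. The two factors combine into an expression that again telescopes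
along a shifted row of length m, giving (v - m(m - 1)) / (v - m(m + 1)) with v = u(u - 1).
Multiplying over the rows gives v · R(v) for the strict partition, and cancelling u yields (1).

For part (2), the up transition probabilities are the residues of these rational functions at the
contents of addable boxes: in u for ordinary diagrams, in v at m(m + 1) for shifted ones. This is
read off from the product formulas of Frobenius and Schur for the path counts
(`dim_eq_frobeniusDim`, `dim_eq_schurDim`), which are proved by checking the recursion of path
counting through partial fraction identities.

Adding a box of content m to the shifted diagram adds boxes of contents m + 1 and -m to the
doubling, and these are the two roots of u(u - 1) = m(m + 1). By (1), a residue p in v splits into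
residues p · m / (2m + 1) at u = m + 1 and p · (m + 1) / (2m + 1) at u = -m. They sum to p. If m =
0, a new row is started: the first weight vanishes, and correspondingly the box of content 1 cannot
be added before the diagonal one. -/

open Finset Filter Topology

/-! ### Path counting in graded graphs -/

/-- Removing the last edge shows that path counts satisfy the recursion imposed on `F`, so strong
induction on the rank identifies them. Finiteness is carried along because `Nat.card` of an infinite
type is 0. The class `P`, closed under predecessors, allows a formula valid only for diagrams with a
bounded number of rows. -/
theorem GraphPath.finite_and_card {V : Type} {E : V → V → Prop} {root : V} (rank : V → ℕ)
    (hrank : ∀ c b, E c b → rank c < rank b) (hroot : ∀ c, ¬ E c root)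
    (P : V → Prop) (F : V → ℝ) (hF : F root = 1)
    (hrec : ∀ b, P b → b ≠ root → ∃ s : Finset V, (∀ c, c ∈ s ↔ E c b) ∧ (∀ c ∈ s, P c) ∧
      F b = ∑ c ∈ s, F c) (b : V) (hb : P b) :
    Finite (GraphPath E root b) ∧ (numPaths E root b : ℝ) = F b := by
  induction hn : rank b using Nat.strong_induction_on generalizing b with
  | _ n ih =>
    subst hn
    by_cases h : b = root
    · subst h
      have : Unique (GraphPath E b b) :=
        { default := GraphPath.nil
          uniq := fun p => by
            cases p with
            | nil => rfl
            | snoc p h => exact absurd h (hroot _) }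
      exact ⟨inferInstance, by simp [numPaths, hF]⟩
    · obtain ⟨s, hs, hP, hsum⟩ := hrec b hb h
      have ih' : ∀ c : s, Finite (GraphPath E root c.1) ∧ (numPaths E root c.1 : ℝ) = F c.1 :=
        fun c => ih _ (hrank _ _ ((hs _).1 c.2)) _ (hP _ c.2) rfl
      have hfin : ∀ c : s, Finite (GraphPath E root c.1) := fun c => (ih' c).1
      let φ : (Σ c : s, GraphPath E root c.1) → GraphPath E root b :=
        fun q => GraphPath.snoc q.2 ((hs _).1 q.1.2)
      have hφ : Function.Bijective φ := by
        constructor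
        · rintro ⟨⟨c, hc⟩, p⟩ ⟨⟨d, hd⟩, q⟩ he
          simp only [φ, GraphPath.snoc.injEq] at he
          obtain ⟨rfl, he⟩ := he
          rw [eq_of_heq he]
        · intro p
          cases p with
          | nil => exact absurd rfl h
          | snoc p hE => exact ⟨⟨⟨_, (hs _).2 hE⟩, p⟩, rfl⟩
      refine ⟨Finite.of_surjective φ hφ.2, ?_⟩
      rw [numPaths, ← Nat.card_eq_of_bijective φ hφ, Nat.card_sigma, hsum, Nat.cast_sum,
        ← Finset.sum_coe_sort s]
      exact Finset.sum_congr rfl fun c _ => (ih' c).2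

/-! ### Partial fractions -/

/-- The coefficients of the partial fraction expansion
`∏ (1 - t_j / (z - x_j)) = 1 - ∑ r_i / (z - x_i)`. -/
noncomputable def partialFractionCoeff {ι K : Type*} [Field K] [DecidableEq ι] (s : Finset ι)
    (x t : ι → K) (i : ι) : K :=
  t i * ∏ j ∈ s.erase i, (1 - t j / (x i - x j))

section
variable {ι K : Type*} [Field K] [DecidableEq ι]

theorem partialFractionCoeff_insert_self {s : Finset ι} {a : ι} (x t : ι → K) (ha : a ∉ s) :
    partialFractionCoeff (insert a s) x t a = t a * ∏ j ∈ s, (1 - t j / (x a - x j)) := by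
  rw [partialFractionCoeff, erase_insert ha]

theorem partialFractionCoeff_insert_of_mem {s : Finset ι} {a i : ι} (x t : ι → K) (ha : a ∉ s)
    (hi : i ∈ s) : partialFractionCoeff (insert a s) x t i =
      partialFractionCoeff s x t i * (1 - t a / (x i - x a)) := by
  have hne : a ≠ i := fun h => ha (h ▸ hi)
  rw [partialFractionCoeff, partialFractionCoeff, erase_insert_of_ne hne, prod_insert]
  · ring
  · simp [ha]

/-- Induction on the set of poles. A new pole `x a` multiplies each old coefficient by `1 - t a / (x
i - x a)`, and its own coefficient is the old product evaluated at `z = x a`, to which the induction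
hypothesis applies. -/
theorem prod_one_sub_div_eq (s : Finset ι) (x t : ι → K) (hx : Set.InjOn x s) (z : K)
    (hz : ∀ i ∈ s, z ≠ x i) :
    ∏ i ∈ s, (1 - t i / (z - x i)) = 1 - ∑ i ∈ s, partialFractionCoeff s x t i / (z - x i) := by
  induction s using Finset.induction_on generalizing z with
  | empty => simp
  | insert a s ha ih =>
    have hxs : Set.InjOn x s := hx.mono (by simp)
    have hax : ∀ i ∈ s, x a ≠ x i := fun i hi h =>
      ha (hx (mem_insert_self a s) (mem_insert_of_mem hi) h ▸ hi)
    rw [prod_insert ha, sum_insert ha, ih hxs z fun i hi => hz i (mem_insert_of_mem hi),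
      partialFractionCoeff_insert_self x t ha, ih hxs (x a) hax]
    have hza : z - x a ≠ 0 := sub_ne_zero.2 (hz a (mem_insert_self a s))
    have h1 : ∑ i ∈ s, partialFractionCoeff (insert a s) x t i / (z - x i) =
        ∑ i ∈ s, partialFractionCoeff s x t i / (z - x i)
        - t a / (z - x a) * (∑ i ∈ s, partialFractionCoeff s x t i / (z - x i)
          - ∑ i ∈ s, partialFractionCoeff s x t i / (x a - x i)) := by
      rw [← sum_sub_distrib, mul_sum, ← sum_sub_distrib]
      refine sum_congr rfl fun i hi => ?_
      rw [partialFractionCoeff_insert_of_mem x t ha hi]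
      have h2 : z - x i ≠ 0 := sub_ne_zero.2 (hz i (mem_insert_of_mem hi))
      have h3 : x a - x i ≠ 0 := sub_ne_zero.2 (hax i hi)
      have h4 : x i - x a ≠ 0 := sub_ne_zero.2 (hax i hi).symm
      field_simp
      ring
    rw [h1]
    ring

/-- Morally a comparison of the coefficients of 1/z at infinity in the partial fraction expansion;
the induction makes this purely algebraic. -/
theorem sum_partialFractionCoeff (s : Finset ι) (x t : ι → K) (hx : Set.InjOn x s) :
    ∑ i ∈ s, partialFractionCoeff s x t i = ∑ i ∈ s, t i := by
  induction s using Finset.induction_on with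
  | empty => simp
  | insert a s ha ih =>
    have hxs : Set.InjOn x s := hx.mono (by simp)
    have hax : ∀ i ∈ s, x a ≠ x i := fun i hi h =>
      ha (hx (mem_insert_self a s) (mem_insert_of_mem hi) h ▸ hi)
    rw [sum_insert ha, sum_insert ha, ← ih hxs, partialFractionCoeff_insert_self x t ha,
      prod_one_sub_div_eq s x t hxs (x a) hax]
    have h1 : ∑ i ∈ s, partialFractionCoeff (insert a s) x t i =
        ∑ i ∈ s, partialFractionCoeff s x t i
        + t a * ∑ i ∈ s, partialFractionCoeff s x t i / (x a - x i) := by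
      rw [mul_sum, ← sum_add_distrib]
      refine sum_congr rfl fun i hi => ?_
      rw [partialFractionCoeff_insert_of_mem x t ha hi]
      have h3 : x a - x i ≠ 0 := sub_ne_zero.2 (hax i hi)
      have h4 : x i - x a ≠ 0 := sub_ne_zero.2 (hax i hi).symm
      field_simp
      ring
    rw [h1]
    ring

/-- The coefficient of 1/z² at infinity, for all `t i = 1`. The factor 2 keeps the identity
meaningful in every characteristic. -/
theorem sum_mul_partialFractionCoeff_one (s : Finset ι) (x : ι → K) (hx : Set.InjOn x s) :
    2 * ∑ i ∈ s, x i * partialFractionCoeff s x (fun _ => 1) i =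
      2 * ∑ i ∈ s, x i - (s.card : K) * ((s.card : K) - 1) := by
  induction s using Finset.induction_on with
  | empty => simp
  | insert a s ha ih =>
    have hxs : Set.InjOn x s := hx.mono (by simp)
    have hax : ∀ i ∈ s, x a ≠ x i := fun i hi h =>
      ha (hx (mem_insert_self a s) (mem_insert_of_mem hi) h ▸ hi)
    rw [sum_insert ha, sum_insert ha, mul_add 2 (x a) (∑ i ∈ s, x i),
      partialFractionCoeff_insert_self x _ ha, prod_one_sub_div_eq s x _ hxs (x a) hax]
    have h1 : ∑ i ∈ s, x i * partialFractionCoeff (insert a s) x (fun _ => 1) i =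
        ∑ i ∈ s, x i * partialFractionCoeff s x (fun _ => 1) i
        + (x a * ∑ i ∈ s, partialFractionCoeff s x (fun _ => 1) i / (x a - x i)
        - ∑ i ∈ s, partialFractionCoeff s x (fun _ => 1) i) := by
      rw [mul_sum, ← sum_sub_distrib, ← sum_add_distrib]
      refine sum_congr rfl fun i hi => ?_
      rw [partialFractionCoeff_insert_of_mem x _ ha hi]
      have h3 : x a - x i ≠ 0 := sub_ne_zero.2 (hax i hi)
      have h4 : x i - x a ≠ 0 := sub_ne_zero.2 (hax i hi).symm
      field_simp
      ring
    have h2 := ih hxs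
    rw [h1, sum_partialFractionCoeff s x _ hxs, card_insert_of_notMem ha]
    simp only [sum_const, nsmul_eq_mul]
    push_cast
    linear_combination h2
end

/-! ### Products over pairs and cancellation at corners -/

/-- The product of `h (l j) (l i)` over pairs `j < i < k`. -/
def pairProd (h : ℝ → ℝ → ℝ) (k : ℕ) (l : ℕ → ℝ) : ℝ :=
  ∏ i ∈ range k, ∏ j ∈ range i, h (l j) (l i)

/-- Only the pairs containing `a` change. The form without division needs no nonvanishing
assumption. By antisymmetry the order inside a pair matters only up to a sign, which is the same on
both sides. -/
theorem pairProd_update (h : ℝ → ℝ → ℝ) (hh : ∀ x y, h x y = -h y x) (k : ℕ) (l l' : ℕ → ℝ)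
    (a : ℕ) (ha : a < k) (hl : ∀ j, j < k → j ≠ a → l' j = l j) :
    pairProd h k l' * ∏ j ∈ (range k).erase a, h (l a) (l j) =
      pairProd h k l * ∏ j ∈ (range k).erase a, h (l' a) (l j) := by
  induction k with
  | zero => omega
  | succ k ih =>
    unfold pairProd at ih ⊢
    rw [prod_range_succ, prod_range_succ]
    rcases Nat.lt_succ_iff_lt_or_eq.1 ha with hak | rfl
    · have ih := ih hak fun j hj => hl j (by omega)
      have hne : k ≠ a := by omega
      have e : (range (k + 1)).erase a = insert k ((range k).erase a) := by
        rw [range_add_one, erase_insert_of_ne hne]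
      have hk : k ∉ (range k).erase a := by simp
      have ham : a ∈ range k := mem_range.2 hak
      rw [e, prod_insert hk, prod_insert hk, ← mul_prod_erase _ (fun j => h (l' j) (l' k)) ham,
        ← mul_prod_erase (range k) (fun j => h (l j) (l k)) ham, hl k (by omega) hne]
      have : ∏ j ∈ (range k).erase a, h (l' j) (l k) = ∏ j ∈ (range k).erase a, h (l j) (l k) :=
        prod_congr rfl fun j hj => by
          rw [mem_erase, mem_range] at hj
          rw [hl j (by omega) hj.1]
      rw [this]
      linear_combination (h (l' a) (l k) * h (l a) (l k) *
        ∏ j ∈ (range k).erase a, h (l j) (l k)) * ih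
    -- When `a` is the last index, it stands second in every pair of `pairProd` but first in the
    -- erased products, so each of them is reversed at the cost of `(-1) ^ a`.
    · have e : (range (a + 1)).erase a = range a := by
        rw [range_add_one, erase_insert (by simp)]
      rw [e]
      have h1 : ∏ i ∈ range a, ∏ j ∈ range i, h (l' j) (l' i) =
          ∏ i ∈ range a, ∏ j ∈ range i, h (l j) (l i) :=
        prod_congr rfl fun i hi => prod_congr rfl fun j hj => by
          rw [mem_range] at hi hj
          rw [hl i (by omega) (by omega), hl j (by omega) (by omega)]
      have h2 : ∀ y, ∏ j ∈ range a, h y (l j) = (-1) ^ a * ∏ j ∈ range a, h (l j) y := fun y => by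
        rw [prod_congr rfl fun j _ => hh y (l j), prod_neg, card_range]
      have h3 : ∏ j ∈ range a, h (l' j) (l' a) = ∏ j ∈ range a, h (l j) (l' a) :=
        prod_congr rfl fun j hj => by
          rw [mem_range] at hj
          rw [hl j (by omega) (by omega)]
      rw [h1, h2, h2, h3]
      ring

theorem pairProd_ne_zero {h : ℝ → ℝ → ℝ} {k : ℕ} {l : ℕ → ℝ}
    (H : ∀ j i, j < i → i < k → h (l j) (l i) ≠ 0) : pairProd h k l ≠ 0 :=
  prod_ne_zero_iff.2 fun i hi => prod_ne_zero_iff.2 fun j hj =>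
    H j i (mem_range.1 hj) (mem_range.1 hi)

/-- `S i` says that there is no corner between rows `i` and `i + 1`. Then the removal factor of row
`i` equals the addition factor of row `i + 1`, so the quotient over corners agrees with the quotient
over all rows. -/
theorem prod_filter_corner {K : Type*} [CommRing K] (S : ℕ → Prop) [DecidablePred S]
    (α β : ℕ → K) (n : ℕ) (h : ∀ i < n, S i → α i = β (i + 1)) :
    (∏ i ∈ range n, α i) * ∏ i ∈ range (n + 1) with (i = 0 ∨ ¬ S (i - 1)), β i =
      (∏ i ∈ range n with ¬ S i, α i) * ∏ i ∈ range (n + 1), β i := by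
  induction n with
  | zero => simp [prod_filter]
  | succ n ih =>
    have ih := ih fun i hi => h i (by omega)
    have hn := h n (by omega)
    simp only [prod_filter] at ih ⊢
    rw [prod_range_succ, prod_range_succ _ (n + 1), prod_range_succ (fun i => if ¬ S i then _ else _),
      prod_range_succ _ (n + 1)]
    simp only [Nat.add_sub_cancel, Nat.add_eq_zero_iff, one_ne_zero, and_false, false_or]
    by_cases hS : S n
    · rw [if_neg (not_not.2 hS), if_neg (not_not.2 hS), hn hS]
      linear_combination β (n + 1) * ih
    · rw [if_pos hS, if_pos hS]
      linear_combination α n * β (n + 1) * ih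

theorem Finset.exists_eq_insert_of_subset_of_card {α : Type*} [DecidableEq α] {s t : Finset α}
    (h : s ⊆ t) (hc : t.card = s.card + 1) : ∃ b ∉ s, t = insert b s := by
  have h1 : (t \ s).card = 1 := by rw [card_sdiff_of_subset h]; omega
  obtain ⟨b, hb⟩ := card_eq_one.1 h1
  have hb' : b ∈ t \ s := by simp [hb]
  refine ⟨b, (mem_sdiff.1 hb').2, ?_⟩
  rw [← sdiff_union_of_subset h, hb]
  rfl

/-! ### Ordinary diagrams: Frobenius' formula and Plancherel transitions -/

namespace YoungDiagram

theorem ext_rowLen {σ ρ : YoungDiagram} (h : ∀ i, σ.rowLen i = ρ.rowLen i) : σ = ρ := by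
  ext ⟨i, j⟩
  rw [mem_cells, mem_cells, mem_iff_lt_rowLen, mem_iff_lt_rowLen, h]

theorem card_bot : (⊥ : YoungDiagram).card = 0 := rfl

theorem exists_rowLen_eq (r : ℕ → ℕ) (hr : Antitone r) (k : ℕ) (hk : r k = 0) :
    ∃ ρ : YoungDiagram, ∀ i, ρ.rowLen i = r i := by
  have hmem : ∀ i j, (i, j) ∈ (range k).biUnion (fun i => {i} ×ˢ range (r i)) ↔ j < r i := by
    intro i j
    simp only [mem_biUnion, mem_range, mem_product, mem_singleton]
    constructor
    · rintro ⟨a, _, rfl, h⟩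
      exact h
    · intro h
      refine ⟨i, ?_, rfl, h⟩
      by_contra hi
      have := hr (not_lt.1 hi)
      omega
  let ρ : YoungDiagram :=
    { cells := (range k).biUnion (fun i => {i} ×ˢ range (r i))
      isLowerSet := by
        rintro ⟨a, b⟩ ⟨a', b'⟩ ⟨ha, hb⟩ h
        rw [mem_coe, hmem] at h ⊢
        have := hr ha
        change b' ≤ b at hb
        change b < r a at h
        change r a ≤ r a' at this
        change b' < r a'
        omega }
  refine ⟨ρ, fun i => ?_⟩
  have key : ∀ j, j < ρ.rowLen i ↔ j < r i := fun j => by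
    rw [← mem_iff_lt_rowLen, ← mem_cells]
    exact hmem i j
  have h1 := key (r i)
  have h2 := key (ρ.rowLen i)
  omega

theorem rowLen_antitone (ρ : YoungDiagram) : Antitone ρ.rowLen := fun _ _ h => ρ.rowLen_anti _ _ h

theorem rowLen_colLen_zero (ρ : YoungDiagram) : ρ.rowLen (ρ.colLen 0) = 0 := by
  by_contra h
  have h1 : (ρ.colLen 0, 0) ∈ ρ := mem_iff_lt_rowLen.2 (Nat.pos_of_ne_zero h)
  exact lt_irrefl _ (mem_iff_lt_colLen.1 h1)

theorem cells_eq_insert_of_rowLen {σ ρ : YoungDiagram} {i : ℕ}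
    (h : ∀ j, ρ.rowLen j = σ.rowLen j + if j = i then 1 else 0) :
    (i, σ.rowLen i) ∉ σ.cells ∧ ρ.cells = insert (i, σ.rowLen i) σ.cells := by
  constructor
  · simp [mem_iff_lt_rowLen]
  · ext ⟨a, b⟩
    rw [mem_insert, mem_cells, mem_cells, mem_iff_lt_rowLen, mem_iff_lt_rowLen, h, Prod.mk.injEq]
    split_ifs with hai
    · subst hai
      omega
    · simp [hai]

theorem rowLen_of_cells_eq_insert {σ ρ : YoungDiagram} {b : ℕ × ℕ} (hb : b ∉ σ.cells)
    (h : ρ.cells = insert b σ.cells) :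
    b.2 = σ.rowLen b.1 ∧ ∀ j, ρ.rowLen j = σ.rowLen j + if j = b.1 then 1 else 0 := by
  have h1 : ∀ j, ρ.rowLen j = σ.rowLen j + if j = b.1 then 1 else 0 := by
    intro j
    rw [rowLen_eq_card, rowLen_eq_card, row, row, h, filter_insert]
    by_cases hj : b.1 = j
    · rw [if_pos hj, if_pos hj.symm, card_insert_of_notMem]
      simp [hb]
    · rw [if_neg hj, if_neg (Ne.symm hj), add_zero]
  refine ⟨?_, h1⟩
  have h2 : b ∈ ρ.cells := by rw [h]; exact mem_insert_self _ _
  obtain ⟨i, j⟩ := b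
  have h3 := mem_iff_lt_rowLen.1 (mem_cells _ |>.1 h2)
  have h4 : ¬ j < σ.rowLen i := fun hlt => hb (mem_cells _ |>.2 (mem_iff_lt_rowLen.2 hlt))
  have h5 := h1 i
  simp only [if_true] at h5 ⊢
  omega

theorem covers_of_cells_eq_insert {σ ρ : YoungDiagram} {b : ℕ × ℕ} (hb : b ∉ σ.cells)
    (h : ρ.cells = insert b σ.cells) : σ.Covers ρ :=
  ⟨cells_subset_iff.1 (h ▸ subset_insert _ _), by
    rw [YoungDiagram.card, h, card_insert_of_notMem hb]⟩

theorem Covers.exists_insert {σ ρ : YoungDiagram} (h : σ.Covers ρ) :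
    ∃ b ∉ σ.cells, ρ.cells = insert b σ.cells :=
  exists_eq_insert_of_subset_of_card (cells_subset_iff.2 h.1) h.2

theorem Covers.exists_rowLen {σ ρ : YoungDiagram} (h : σ.Covers ρ) :
    ∃ i, ∀ j, ρ.rowLen j = σ.rowLen j + if j = i then 1 else 0 := by
  obtain ⟨b, hb, he⟩ := h.exists_insert
  exact ⟨b.1, (rowLen_of_cells_eq_insert hb he).2⟩

theorem covers_of_rowLen {σ ρ : YoungDiagram} {i : ℕ}
    (h : ∀ j, ρ.rowLen j = σ.rowLen j + if j = i then 1 else 0) : σ.Covers ρ :=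
  covers_of_cells_eq_insert (cells_eq_insert_of_rowLen h).1 (cells_eq_insert_of_rowLen h).2

theorem prod_cells {M : Type*} [CommMonoid M] (ρ : YoungDiagram) (k : ℕ) (hk : ρ.rowLen k = 0)
    (f : ℕ × ℕ → M) : ∏ b ∈ ρ.cells, f b = ∏ i ∈ range k, ∏ j ∈ range (ρ.rowLen i), f (i, j) := by
  rw [Finset.prod_sigma']
  refine prod_bij' (fun b _ => ⟨b.1, b.2⟩) (fun b _ => (b.1, b.2)) ?_ ?_ ?_ ?_ ?_
  · rintro ⟨i, j⟩ h
    rw [mem_cells, mem_iff_lt_rowLen] at h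
    simp only [mem_sigma, mem_range]
    refine ⟨?_, h⟩
    by_contra hi
    have := ρ.rowLen_antitone (not_lt.1 hi)
    omega
  · rintro ⟨i, j⟩ h
    simp only [mem_sigma, mem_range] at h
    rw [mem_cells, mem_iff_lt_rowLen]
    exact h.2
  · intros; rfl
  · intros; rfl
  · intros; rfl

theorem card_eq_sum_rowLen (ρ : YoungDiagram) (k : ℕ) (hk : ρ.rowLen k = 0) :
    ρ.card = ∑ i ∈ range k, ρ.rowLen i := by
  have h := ρ.prod_cells k hk (fun _ => Multiplicative.ofAdd 1)
  simp only [prod_const, ← ofAdd_nsmul, ← ofAdd_sum, smul_eq_mul, mul_one, card_range] at h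
  exact Multiplicative.ofAdd.injective h

/-- The shifted row lengths `λ_j + k - 1 - j`. -/
def beta (ρ : YoungDiagram) (k j : ℕ) : ℕ := ρ.rowLen j + (k - 1 - j)

/-- Frobenius' formula for the number of standard tableaux, in terms of the first `k` rows. -/
noncomputable def frobeniusDim (k : ℕ) (ρ : YoungDiagram) : ℝ :=
  (ρ.card.factorial : ℝ) * pairProd (fun x y => x - y) k (fun j => (ρ.beta k j : ℝ)) /
    ∏ j ∈ range k, ((ρ.beta k j).factorial : ℝ)

theorem beta_lt_beta (ρ : YoungDiagram) {k i j : ℕ} (hij : i < j) (hj : j < k) :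
    ρ.beta k j < ρ.beta k i := by
  have := ρ.rowLen_antitone hij.le
  unfold beta
  omega

theorem beta_ne_beta (ρ : YoungDiagram) {k i j : ℕ} (hij : i ≠ j) (hi : i < k) (hj : j < k) :
    (ρ.beta k i : ℝ) ≠ ρ.beta k j := by
  refine Nat.cast_injective.ne ?_
  rcases lt_or_gt_of_ne hij with h | h
  · exact (ρ.beta_lt_beta h hj).ne'
  · exact (ρ.beta_lt_beta h hi).ne

theorem frobeniusDim_ne_zero (k : ℕ) (ρ : YoungDiagram) : frobeniusDim k ρ ≠ 0 := by
  refine div_ne_zero (mul_ne_zero (by positivity) (pairProd_ne_zero fun j i hji hi => ?_))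
    (by positivity)
  exact sub_ne_zero.2 (ρ.beta_ne_beta hji.ne (by omega) hi)

theorem frobeniusDim_bot (k : ℕ) : frobeniusDim k ⊥ = 1 := by
  have h0 : ∀ i, (⊥ : YoungDiagram).rowLen i = 0 := fun i => by
    by_contra h
    exact notMem_bot _ (mem_iff_lt_rowLen.2 (Nat.pos_of_ne_zero h))
  have hfact : ∀ i : ℕ, ∏ j ∈ range i, ((i : ℝ) - j) = i.factorial := by
    intro i
    induction i with
    | zero => simp
    | succ i ih =>
      rw [prod_range_succ', Nat.factorial_succ]
      push_cast
      simp only [add_sub_add_right_eq_sub, ih]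
      ring
  have h1 : pairProd (fun x y => x - y) k (fun j => ((⊥ : YoungDiagram).beta k j : ℝ)) =
      ∏ i ∈ range k, (i.factorial : ℝ) := by
    refine prod_congr rfl fun i hi => ?_
    rw [← hfact]
    refine prod_congr rfl fun j hj => ?_
    rw [mem_range] at hi hj
    simp only [beta, h0, zero_add]
    rw [show k - 1 - j = k - 1 - i + (i - j) by omega, Nat.cast_add, Nat.cast_sub hj.le]
    ring
  have h2 : ∏ j ∈ range k, (((⊥ : YoungDiagram).beta k j).factorial : ℝ) =
      ∏ i ∈ range k, (i.factorial : ℝ) := by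
    simp only [beta, h0, zero_add]
    exact prod_range_reflect (fun i => (i.factorial : ℝ)) k
  rw [frobeniusDim, h1, h2, card_bot, Nat.factorial_zero, Nat.cast_one, one_mul, div_self]
  positivity

/-- Removing a box from row `i` lowers a single shifted length β_i by one. The factorials contribute
β_i and the differences contribute ∏ (β_i - 1 - β_j) / (β_i - β_j), which is the partial fraction
coefficient at β_i. -/
theorem frobeniusDim_of_covers {σ ρ : YoungDiagram} {i k : ℕ} (hi : i < k)
    (h : ∀ j, ρ.rowLen j = σ.rowLen j + if j = i then 1 else 0) :
    frobeniusDim k σ = frobeniusDim k ρ / ρ.card * ((ρ.beta k i : ℝ) *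
      partialFractionCoeff (range k) (fun j => (ρ.beta k j : ℝ)) (fun _ => 1) i) := by
  have hcard : ρ.card = σ.card + 1 := (covers_of_rowLen h).2
  have hbi : ρ.beta k i = σ.beta k i + 1 := by simp only [beta, h, if_true]; omega
  have hbj : ∀ j, j ≠ i → ρ.beta k j = σ.beta k j := fun j hj => by simp [beta, h, hj]
  have hD := pairProd_update (fun x y => x - y) (fun x y => by ring) k
    (fun j => (ρ.beta k j : ℝ)) (fun j => (σ.beta k j : ℝ)) i hi
    (fun j _ hj => by simp [hbj j hj])
  have him : i ∈ range k := mem_range.2 hi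
  have hfac : ∏ j ∈ range k, ((ρ.beta k j).factorial : ℝ) =
      ρ.beta k i * ∏ j ∈ range k, ((σ.beta k j).factorial : ℝ) := by
    rw [← mul_prod_erase _ _ him, ← mul_prod_erase _ (fun j => ((σ.beta k j).factorial : ℝ)) him,
      hbi, Nat.factorial_succ]
    have : ∏ j ∈ (range k).erase i, ((ρ.beta k j).factorial : ℝ) =
        ∏ j ∈ (range k).erase i, ((σ.beta k j).factorial : ℝ) :=
      prod_congr rfl fun j hj => by rw [hbj j (mem_erase.1 hj).1]
    rw [this]
    push_cast
    ring
  have hne : ∏ j ∈ (range k).erase i, ((ρ.beta k i : ℝ) - ρ.beta k j) ≠ 0 :=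
    prod_ne_zero_iff.2 fun j hj => by
      rw [mem_erase, mem_range] at hj
      exact sub_ne_zero.2 (ρ.beta_ne_beta hj.1.symm hi hj.2)
  have hcoef : partialFractionCoeff (range k) (fun j => (ρ.beta k j : ℝ)) (fun _ => 1) i =
      (∏ j ∈ (range k).erase i, ((σ.beta k i : ℝ) - ρ.beta k j)) /
        ∏ j ∈ (range k).erase i, ((ρ.beta k i : ℝ) - ρ.beta k j) := by
    rw [partialFractionCoeff, one_mul, ← prod_div_distrib]
    refine prod_congr rfl fun j hj => ?_
    rw [mem_erase, mem_range] at hj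
    have := sub_ne_zero.2 (ρ.beta_ne_beta hj.1.symm hi hj.2)
    rw [hbi] at this ⊢
    push_cast at this ⊢
    field_simp
    ring
  have hb0 : (ρ.beta k i : ℝ) ≠ 0 := by rw [hbi]; positivity
  have hf0 : ∏ j ∈ range k, ((σ.beta k j).factorial : ℝ) ≠ 0 := by positivity
  have hc0 : (σ.card : ℝ) + 1 ≠ 0 := by positivity
  rw [frobeniusDim, frobeniusDim, hcoef, hfac, hcard, Nat.factorial_succ]
  rw [mul_comm] at hD
  push_cast
  field_simp
  linear_combination hD

/-- The formula satisfies the path recursion because ∑ β_i r_i = ∑ β_i - k(k - 1)/2 = |ρ|, where r_i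
are the coefficients from the previous lemma. The number `k` of rows stays fixed, which is harmless
since empty rows are allowed. -/
theorem dim_eq_frobeniusDim (k : ℕ) (ρ : YoungDiagram) (hk : ρ.rowLen k = 0) :
    (ρ.dim : ℝ) = frobeniusDim k ρ := by
  classical
  refine (GraphPath.finite_and_card (E := Covers) YoungDiagram.card (fun c b h => ?_) (fun c h => ?_)
    (fun ρ => ρ.rowLen k = 0) (frobeniusDim k) (frobeniusDim_bot k) (fun ρ hρ hne => ?_) ρ hk).2
  · have := h.2
    omega
  · have := h.2
    rw [card_bot] at this
    omega
  · set I := (range k).filter fun i => ρ.rowLen (i + 1) < ρ.rowLen i with hI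
    have hex : ∀ i ∈ I, ∃ σ : YoungDiagram,
        ∀ j, ρ.rowLen j = σ.rowLen j + if j = i then 1 else 0 := by
      intro i hi
      rw [hI, mem_filter, mem_range] at hi
      obtain ⟨σ, hσ⟩ := exists_rowLen_eq (fun j => ρ.rowLen j - if j = i then 1 else 0)
        (antitone_nat_of_succ_le fun j => by
          have := ρ.rowLen_antitone (Nat.le_succ j)
          by_cases hj : j = i
          · subst hj
            simp only [Nat.succ_ne_self, if_true, if_false]
            omega
          · simp only [if_neg hj]
            exact (Nat.sub_le _ _).trans this) k (by simp [hρ])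
      refine ⟨σ, fun j => ?_⟩
      rw [hσ]
      split_ifs with hj
      · subst hj
        omega
      · rfl
    choose! pred hpred using hex
    have hinj : Set.InjOn pred I := by
      intro a ha b hb hab
      have h1 := hpred a ha a
      have h2 := hpred b hb a
      rw [hab, if_pos rfl] at h1
      by_contra hne
      rw [if_neg hne] at h2
      omega
    refine ⟨I.image pred, fun σ => ?_, fun σ hσ => ?_, ?_⟩
    · rw [mem_image]
      constructor
      · rintro ⟨i, hi, rfl⟩
        exact covers_of_rowLen (hpred i hi)
      · intro h
        obtain ⟨i, hi⟩ := h.exists_rowLen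
        have hiI : i ∈ I := by
          have h1 := hi i
          have h2 := hi (i + 1)
          have h3 := σ.rowLen_antitone (Nat.le_succ i)
          simp only [if_true, Nat.succ_ne_self, Nat.succ_eq_add_one, if_false] at h1 h2 h3
          rw [hI, mem_filter, mem_range]
          refine ⟨?_, by omega⟩
          by_contra hik
          have := ρ.rowLen_antitone (not_lt.1 hik)
          omega
        refine ⟨i, hiI, ext_rowLen fun j => ?_⟩
        have h1 := hi j
        have h2 := hpred i hiI j
        omega
    · obtain ⟨i, hi, rfl⟩ := mem_image.1 hσ
      have := hpred i hi k
      omega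
    · have hc0 : (ρ.card : ℝ) ≠ 0 := by
        rw [Nat.cast_ne_zero]
        intro h
        apply hne
        apply YoungDiagram.ext
        rw [cells_bot]
        exact card_eq_zero.1 h
      have hinjx : Set.InjOn (fun j => (ρ.beta k j : ℝ)) (range k) := by
        intro a ha b hb hab
        by_contra hne
        exact ρ.beta_ne_beta hne (by simpa using ha) (by simpa using hb) hab
      have hsum := sum_mul_partialFractionCoeff_one (range k) (fun j => (ρ.beta k j : ℝ)) hinjx
      have hbeta : 2 * ∑ j ∈ range k, (ρ.beta k j : ℝ) = 2 * ρ.card + (k : ℝ) * ((k : ℝ) - 1) := by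
        rw [ρ.card_eq_sum_rowLen k hρ]
        simp only [beta, Nat.cast_add, sum_add_distrib]
        have := prod_range_reflect (fun i => Multiplicative.ofAdd (i : ℝ)) k
        simp only [← ofAdd_sum] at this
        have := Multiplicative.ofAdd.injective this
        have h2 := Finset.sum_range_id_mul_two k
        rw [this]
        rcases Nat.eq_zero_or_pos k with rfl | hk
        · simp
        have h3 := congrArg (Nat.cast : ℕ → ℝ) h2
        push_cast [Nat.cast_sub hk] at h3 ⊢
        linear_combination h3
      rw [sum_image hinj, sum_congr rfl fun i hi => frobeniusDim_of_covers
        (mem_range.1 (mem_filter.1 hi).1) (hpred i hi), ← mul_sum, sum_filter_of_ne]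
      · rw [hbeta, card_range] at hsum
        have : ∑ i ∈ range k, (ρ.beta k i : ℝ) *
            partialFractionCoeff (range k) (fun j => (ρ.beta k j : ℝ)) (fun _ => 1) i = ρ.card := by
          linear_combination hsum / 2
        rw [this]
        field_simp
      -- A row without a removable box contributes 0, so the sum over predecessors may be extended
      -- to all rows.
      · intro i hi hne
        rw [mem_range] at hi
        by_contra hlt
        have heq : ρ.rowLen (i + 1) = ρ.rowLen i :=
          le_antisymm (ρ.rowLen_antitone (Nat.le_succ i)) (not_lt.1 hlt)
        apply hne
        by_cases hik : i + 1 < k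
        · have hb : ρ.beta k i = ρ.beta k (i + 1) + 1 := by unfold beta; omega
          -- Equal consecutive rows have β_i - β_{i+1} = 1, which kills the factor `1 - 1 / (β_i -
          -- β_{i+1})`.
          rw [partialFractionCoeff, prod_eq_zero (i := i + 1), mul_zero, mul_zero]
          · simp [hik]
          · rw [hb]
            push_cast
            rw [add_sub_cancel_left]
            norm_num
        · have : ρ.beta k i = 0 := by
            have : i + 1 = k := by omega
            unfold beta
            rw [← heq, this, hρ]
            omega
          rw [this, Nat.cast_zero, zero_mul]

/-- The transition probability as a residue, in terms of the row contents. -/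
theorem plancherelUp_eq {σ ρ : YoungDiagram} {i k : ℕ} (hi : i < k) (hk : σ.rowLen k = 0)
    (h : ∀ j, ρ.rowLen j = σ.rowLen j + if j = i then 1 else 0) :
    σ.plancherelUp ρ = (∏ j ∈ (range k).erase i,
        (((σ.rowLen i : ℝ) - i - (σ.rowLen j - j) + 1) / ((σ.rowLen i : ℝ) - i - (σ.rowLen j - j)))) /
      ((σ.rowLen i : ℝ) - i + k) := by
  have hcov := covers_of_rowLen h
  have hk' : ρ.rowLen k = 0 := by rw [h, hk, if_neg hi.ne']
  have hb : ∀ j ∈ range k, (σ.beta k j : ℝ) = σ.rowLen j - j + (k - 1) := by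
    intro j hj
    rw [mem_range] at hj
    rw [beta, Nat.cast_add, Nat.cast_sub (by omega), Nat.cast_sub (by omega)]
    push_cast
    ring
  have him : i ∈ range k := mem_range.2 hi
  have hbi : (ρ.beta k i : ℝ) = σ.beta k i + 1 := by
    simp only [beta, h, if_true]
    push_cast
    ring
  have hbj : ∀ j, j ≠ i → ρ.beta k j = σ.beta k j := fun j hj => by simp [beta, h, hj]
  have hs0 := frobeniusDim_ne_zero k σ
  have hr0 := frobeniusDim_ne_zero k ρ
  have hstep := frobeniusDim_of_covers hi h
  have hc0 : (σ.card : ℝ) + 1 ≠ 0 := by positivity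
  have hf0 : (σ.card.factorial : ℝ) ≠ 0 := by positivity
  have e1 : σ.plancherelUp ρ = frobeniusDim k ρ / (frobeniusDim k σ * (σ.card + 1)) := by
    rw [plancherelUp, upProb, if_pos hcov, downProb, if_pos hcov]
    change (σ.dim : ℝ) / (ρ.dim : ℝ) * ρ.plancherel / σ.plancherel = _
    rw [plancherel, plancherel, dim_eq_frobeniusDim k σ hk, dim_eq_frobeniusDim k ρ hk', hcov.2,
      Nat.factorial_succ]
    push_cast
    field_simp
  -- The transition probability is f_ρ / ((n + 1) f_σ), so the step formula enters inverted.
  have e2 : partialFractionCoeff (range k) (fun j => (ρ.beta k j : ℝ)) (fun _ => 1) i =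
      (∏ j ∈ (range k).erase i, (((σ.rowLen i : ℝ) - i - (σ.rowLen j - j) + 1) /
        ((σ.rowLen i : ℝ) - i - (σ.rowLen j - j))))⁻¹ := by
    rw [partialFractionCoeff, one_mul, ← prod_inv_distrib]
    refine prod_congr rfl fun j hj => ?_
    have hj' := mem_erase.1 hj
    have hne : (ρ.beta k i : ℝ) - ρ.beta k j ≠ 0 :=
      sub_ne_zero.2 (ρ.beta_ne_beta hj'.1.symm hi (mem_range.1 hj'.2))
    rw [hbj j hj'.1, hbi, hb i him, hb j hj'.2] at hne ⊢
    rw [inv_div]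
    have e : (σ.rowLen i : ℝ) - i + (k - 1) + 1 - (σ.rowLen j - j + (k - 1)) =
      (σ.rowLen i : ℝ) - i - (σ.rowLen j - j) + 1 := by ring
    rw [e] at hne ⊢
    rw [one_sub_div hne, add_sub_cancel_right]
  have e3 : (ρ.beta k i : ℝ) = (σ.rowLen i : ℝ) - i + k := by
    rw [hbi, hb i him]
    ring
  rw [hcov.2, e2, e3] at hstep
  set Q := ∏ j ∈ (range k).erase i, (((σ.rowLen i : ℝ) - i - (σ.rowLen j - j) + 1) /
        ((σ.rowLen i : ℝ) - i - (σ.rowLen j - j)))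
  have hx0 : (σ.rowLen i : ℝ) - i + k ≠ 0 := by
    rw [← e3, hbi]
    positivity
  have hQ : Q ≠ 0 := by
    intro hQ
    rw [hQ] at hstep
    simp only [inv_zero, mul_zero] at hstep
    exact hs0 hstep
  rw [e1, hstep]
  push_cast
  field_simp

end YoungDiagram

/-! ### Strict partitions: Schur's formula and Plancherel transitions -/

namespace StrictPartition

theorem part_ne_zero_iff (lam : StrictPartition) (i : ℕ) : lam.part i ≠ 0 ↔ i < lam.length := by
  have key : ∀ n, (∀ j, j < n → lam.part j ≠ 0) ↔ n ≤ lam.length := by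
    intro n
    constructor
    · intro h
      have : range n ⊆ lam.part.support := fun j hj =>
        Finsupp.mem_support_iff.2 (h j (mem_range.1 hj))
      simpa [length] using card_le_card this
    · intro h j hj h0
      have : lam.part.support ⊆ range j := fun a ha => by
        rw [mem_range]
        by_contra hja
        have := lam.antitone (not_lt.1 hja)
        rw [Finsupp.mem_support_iff] at ha
        omega
      have := card_le_card this
      rw [card_range] at this
      unfold length at h
      omega
  constructor
  · intro h
    refine (key (i + 1)).1 fun j hj hj0 => h ?_
    have := lam.antitone (Nat.lt_succ_iff.1 hj)
    omega
  · intro h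
    exact (key (i + 1)).2 h i (Nat.lt_succ_self i)

theorem support_eq (lam : StrictPartition) : lam.part.support = range lam.length := by
  ext i
  rw [Finsupp.mem_support_iff, part_ne_zero_iff, mem_range]

theorem part_eq_zero (lam : StrictPartition) {i : ℕ} (h : lam.length ≤ i) : lam.part i = 0 := by
  by_contra h0
  have := (lam.part_ne_zero_iff i).1 h0
  omega

theorem part_lt_part (lam : StrictPartition) {i j : ℕ} (hij : i < j) (hi : i < lam.length) :
    lam.part j < lam.part i := by
  have h1 := lam.antitone hij.le
  have h2 := (lam.part_ne_zero_iff i).2 hi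
  exact lt_of_le_of_ne h1 fun h => hij.ne (lam.strict i j h2 h.symm)

theorem length_eq_iff (lam : StrictPartition) (n : ℕ) :
    lam.length = n ↔ (∀ i, lam.part i ≠ 0 ↔ i < n) := by
  constructor
  · rintro rfl i
    exact lam.part_ne_zero_iff i
  · intro h
    have h1 := (lam.part_ne_zero_iff n).symm.trans (h n)
    have h2 := (lam.part_ne_zero_iff lam.length).symm.trans (h lam.length)
    omega

theorem weight_eq_sum (lam : StrictPartition) :
    lam.weight = ∑ i ∈ range lam.length, lam.part i := by
  rw [weight, support_eq]

theorem prod_cells {M : Type*} [CommMonoid M] (lam : StrictPartition) (f : ℕ × ℕ → M) :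
    ∏ b ∈ lam.cells, f b =
      ∏ i ∈ range lam.length, ∏ c ∈ range (lam.part i), f (i, i + c) := by
  rw [Finset.prod_sigma']
  refine prod_bij' (fun b _ => ⟨b.1, b.2 - b.1⟩) (fun b _ => (b.1, b.1 + b.2)) ?_ ?_ ?_ ?_ ?_
  · rintro ⟨i, j⟩ h
    rw [mem_cells] at h
    simp only [mem_sigma, mem_range]
    refine ⟨(lam.part_ne_zero_iff i).1 (by omega), by omega⟩
  · rintro ⟨i, j⟩ h
    simp only [mem_sigma, mem_range] at h
    rw [mem_cells]
    exact ⟨Nat.le_add_right _ _, Nat.add_lt_add_left h.2 _⟩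
  · rintro ⟨i, j⟩ h
    rw [mem_cells] at h
    simp only [Prod.mk.injEq, true_and]
    omega
  · rintro ⟨i, j⟩ h
    simp
  · rintro ⟨i, j⟩ h
    rw [mem_cells] at h
    simp only
    rw [Nat.add_sub_cancel' h.1]

theorem card_cells (lam : StrictPartition) : lam.cells.card = lam.weight := by
  have h := lam.prod_cells (fun _ => Multiplicative.ofAdd 1)
  simp only [prod_const, ← ofAdd_nsmul, ← ofAdd_sum, smul_eq_mul, mul_one, card_range] at h
  rw [weight_eq_sum]
  exact Multiplicative.ofAdd.injective h

theorem card_row (lam : StrictPartition) (i : ℕ) :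
    (lam.cells.filter fun b => b.1 = i).card = lam.part i := by
  have : (lam.cells.filter fun b => b.1 = i) = {i} ×ˢ Ico i (i + lam.part i) := by
    ext ⟨a, b⟩
    simp only [mem_filter, mem_cells, mem_product, mem_singleton, mem_Ico]
    constructor
    · rintro ⟨h, rfl⟩
      exact ⟨rfl, h⟩
    · rintro ⟨rfl, h⟩
      exact ⟨h, rfl⟩
  rw [this]
  simp

theorem ext_part {mu lam : StrictPartition} (h : ∀ i, mu.part i = lam.part i) : mu = lam :=
  StrictPartition.ext (Finsupp.ext h)

theorem exists_part_eq (r : ℕ → ℕ) (k : ℕ) (hr : ∀ i, r i ≠ 0 → r (i + 1) < r i)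
    (h0 : ∀ i, r i = 0 → r (i + 1) = 0) (hk : ∀ i, k ≤ i → r i = 0) :
    ∃ lam : StrictPartition, ∀ i, lam.part i = r i := by
  have hanti : Antitone r := antitone_nat_of_succ_le fun i => by
    by_cases h : r i = 0
    · rw [h0 i h]; exact Nat.zero_le _
    · exact (hr i h).le
  refine ⟨⟨Finsupp.onFinset (range k) r fun i hi => ?_, ?_, ?_⟩, fun i => rfl⟩
  · rw [mem_range]
    by_contra h
    exact hi (hk i (not_lt.1 h))
  · exact hanti
  · have key : ∀ i j, i < j → r i ≠ 0 → r j < r i := fun i j hij hi =>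
      (hanti (Nat.succ_le_of_lt hij)).trans_lt (hr i hi)
    intro i j hi hij
    change r i = r j at hij
    change r i ≠ 0 at hi
    rcases lt_trichotomy i j with h | h | h
    · have := key i j h hi
      omega
    · exact h
    · have := key j i h (hij ▸ hi)
      omega

theorem cells_eq_insert_of_part {mu lam : StrictPartition} {i : ℕ}
    (h : ∀ j, lam.part j = mu.part j + if j = i then 1 else 0) :
    (i, i + mu.part i) ∉ mu.cells ∧ lam.cells = insert (i, i + mu.part i) mu.cells := by
  constructor
  · simp [mem_cells]
  · ext ⟨a, b⟩
    rw [mem_insert, mem_cells, mem_cells, h, Prod.mk.injEq]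
    split_ifs with hai
    · subst hai
      omega
    · simp [hai]

theorem part_of_cells_eq_insert {mu lam : StrictPartition} {b : ℕ × ℕ} (hb : b ∉ mu.cells)
    (h : lam.cells = insert b mu.cells) :
    b.2 = b.1 + mu.part b.1 ∧ ∀ j, lam.part j = mu.part j + if j = b.1 then 1 else 0 := by
  have h1 : ∀ j, lam.part j = mu.part j + if j = b.1 then 1 else 0 := by
    intro j
    rw [← card_row, ← card_row, h, filter_insert]
    by_cases hj : b.1 = j
    · rw [if_pos hj, if_pos hj.symm, card_insert_of_notMem]
      simp [hb]
    · rw [if_neg hj, if_neg (Ne.symm hj), add_zero]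
  refine ⟨?_, h1⟩
  have h2 : b ∈ lam.cells := by rw [h]; exact mem_insert_self _ _
  obtain ⟨i, j⟩ := b
  rw [mem_cells] at h2 hb
  have h5 := h1 i
  simp only [if_true] at h5 ⊢
  omega

theorem Covers.exists_insert {mu lam : StrictPartition} (h : mu.Covers lam) :
    ∃ b ∉ mu.cells, lam.cells = insert b mu.cells :=
  exists_eq_insert_of_subset_of_card h.1 (by rw [card_cells, card_cells, h.2])

theorem Covers.exists_part {mu lam : StrictPartition} (h : mu.Covers lam) :
    ∃ i, ∀ j, lam.part j = mu.part j + if j = i then 1 else 0 := by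
  obtain ⟨b, hb, he⟩ := h.exists_insert
  exact ⟨b.1, (part_of_cells_eq_insert hb he).2⟩

theorem covers_of_part {mu lam : StrictPartition} {i : ℕ}
    (h : ∀ j, lam.part j = mu.part j + if j = i then 1 else 0) : mu.Covers lam := by
  obtain ⟨hb, he⟩ := cells_eq_insert_of_part h
  refine ⟨he ▸ subset_insert _ _, ?_⟩
  rw [← card_cells, ← card_cells, he, card_insert_of_notMem hb]

theorem lt_length_of_part {mu lam : StrictPartition} {i : ℕ}
    (h : ∀ j, lam.part j = mu.part j + if j = i then 1 else 0) : i < lam.length := by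
  refine (lam.part_ne_zero_iff i).1 ?_
  rw [h, if_pos rfl]
  omega

/-- Adding a box to an empty row increases the length. -/
theorem length_of_part_eq_zero {mu lam : StrictPartition} {i : ℕ}
    (h : ∀ j, lam.part j = mu.part j + if j = i then 1 else 0) (hi : mu.part i = 0) :
    i = mu.length ∧ lam.length = mu.length + 1 := by
  have h1 := mu.part_ne_zero_iff i
  have h2 := lt_length_of_part h
  have h3 : i = mu.length := by
    by_contra hne
    have h4 := lam.part_lt_part (i := mu.length) (j := i) (by omega) (by omega)
    rw [h mu.length, if_neg (Ne.symm hne), mu.part_eq_zero le_rfl] at h4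
    omega
  refine ⟨h3, (lam.length_eq_iff _).2 fun j => ?_⟩
  have h5 := mu.part_ne_zero_iff j
  rw [h]
  split_ifs with hj <;> omega

theorem length_of_part_ne_zero {mu lam : StrictPartition} {i : ℕ}
    (h : ∀ j, lam.part j = mu.part j + if j = i then 1 else 0) (hi : mu.part i ≠ 0) :
    i < mu.length ∧ lam.length = mu.length := by
  have h1 := (mu.part_ne_zero_iff i).1 hi
  refine ⟨h1, (lam.length_eq_iff _).2 fun j => ?_⟩
  have h5 := mu.part_ne_zero_iff j
  rw [h]
  split_ifs with hj <;> omega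

/-- Schur's formula for the number of standard shifted tableaux, in terms of the first `k` rows. -/
noncomputable def schurDim (k : ℕ) (lam : StrictPartition) : ℝ :=
  (lam.weight.factorial : ℝ) * pairProd (fun x y => (x - y) / (x + y)) k
    (fun j => (lam.part j : ℝ)) / ∏ j ∈ range k, ((lam.part j).factorial : ℝ)

/-- One empty row is harmless, since (x - 0)/(x + 0) = 1 for x ≠ 0. Two would give 0/0 = 0, so,
unlike for Frobenius' formula, the number of rows cannot be fixed once and for all. A single extra
row is enough to compare two neighbours. -/
theorem schurDim_length_succ (lam : StrictPartition) :
    schurDim (lam.length + 1) lam = schurDim lam.length lam := by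
  unfold schurDim pairProd
  beta_reduce
  rw [prod_range_succ, prod_range_succ (fun j => ((lam.part j).factorial : ℝ)),
    lam.part_eq_zero le_rfl, prod_eq_one (s := range lam.length)
      (f := fun j => ((lam.part j : ℝ) - ((0 : ℕ) : ℝ)) / (lam.part j + ((0 : ℕ) : ℝ)))]
  · simp
  · intro j hj
    have := (lam.part_ne_zero_iff j).2 (mem_range.1 hj)
    have : (lam.part j : ℝ) ≠ 0 := Nat.cast_ne_zero.2 this
    simp [this]

theorem schurDim_length_of_part {mu lam : StrictPartition} {i : ℕ}
    (h : ∀ j, lam.part j = mu.part j + if j = i then 1 else 0) :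
    schurDim lam.length mu = schurDim mu.length mu := by
  by_cases hi : mu.part i = 0
  · rw [(length_of_part_eq_zero h hi).2, schurDim_length_succ]
  · rw [(length_of_part_ne_zero h hi).2]

theorem part_sub_part_ne_zero (lam : StrictPartition) {i j : ℕ} (hij : i ≠ j) (hi : i < lam.length) :
    (lam.part i : ℝ) - lam.part j ≠ 0 :=
  sub_ne_zero.2 fun h =>
    hij (lam.strict i j ((lam.part_ne_zero_iff i).2 hi) (Nat.cast_injective h))

theorem schurDim_ne_zero (lam : StrictPartition) : schurDim lam.length lam ≠ 0 := by
  refine div_ne_zero (mul_ne_zero (by positivity) (pairProd_ne_zero fun j i hji hi => ?_))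
    (by positivity)
  refine div_ne_zero (lam.part_sub_part_ne_zero hji.ne (hji.trans hi)) ?_
  have := Nat.pos_of_ne_zero ((lam.part_ne_zero_iff i).2 hi)
  positivity

theorem part_mul_pred_sub_ne_zero (lam : StrictPartition) {i j : ℕ} (hij : i ≠ j)
    (hi : i < lam.length) (hj : j < lam.length) :
    (lam.part i : ℝ) * (lam.part i - 1) - lam.part j * (lam.part j - 1) ≠ 0 := by
  have h1 : 1 ≤ (lam.part i : ℝ) :=
    Nat.one_le_cast.2 (Nat.pos_of_ne_zero ((lam.part_ne_zero_iff i).2 hi))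
  have h2 : 1 ≤ (lam.part j : ℝ) :=
    Nat.one_le_cast.2 (Nat.pos_of_ne_zero ((lam.part_ne_zero_iff j).2 hj))
  have e : (lam.part i : ℝ) * (lam.part i - 1) - lam.part j * (lam.part j - 1) =
    (lam.part i - lam.part j) * (lam.part i + lam.part j - 1) := by ring
  rw [e]
  exact mul_ne_zero (lam.part_sub_part_ne_zero hij hi) (by linarith)

/-- With x_j = λ_j(λ_j - 1), the difference x_i - x_j - 2λ_j factors as (λ_i - 1 - λ_j)(λ_i + λ_j),
and x_i - x_j as (λ_i - λ_j)(λ_i + λ_j - 1). Hence `1 - 2λ_j / (x_i - x_j)` is exactly the change of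
the pair factor (λ_i - λ_j)/(λ_i + λ_j). -/
theorem schurDim_of_covers {mu lam : StrictPartition} {i : ℕ}
    (h : ∀ j, lam.part j = mu.part j + if j = i then 1 else 0) :
    schurDim mu.length mu = schurDim lam.length lam / lam.weight *
      (partialFractionCoeff (range lam.length) (fun j => (lam.part j : ℝ) * (lam.part j - 1))
        (fun j => 2 * (lam.part j : ℝ)) i / 2) := by
  rw [← schurDim_length_of_part h]
  have hi := lt_length_of_part h
  set k := lam.length with hk
  have hcard : lam.weight = mu.weight + 1 := (covers_of_part h).2
  have hbi : lam.part i = mu.part i + 1 := by simp [h]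
  have hbj : ∀ j, j ≠ i → lam.part j = mu.part j := fun j hj => by simp [h, hj]
  have hD := pairProd_update (fun x y => (x - y) / (x + y))
    (fun x y => by rw [add_comm y x, ← neg_div, neg_sub]) k
    (fun j => (lam.part j : ℝ)) (fun j => (mu.part j : ℝ)) i hi
    (fun j _ hj => by simp [hbj j hj])
  have him : i ∈ range k := mem_range.2 hi
  have hfac : ∏ j ∈ range k, ((lam.part j).factorial : ℝ) =
      lam.part i * ∏ j ∈ range k, ((mu.part j).factorial : ℝ) := by
    rw [← mul_prod_erase _ _ him, ← mul_prod_erase _ (fun j => ((mu.part j).factorial : ℝ)) him,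
      hbi, Nat.factorial_succ]
    have : ∏ j ∈ (range k).erase i, ((lam.part j).factorial : ℝ) =
        ∏ j ∈ (range k).erase i, ((mu.part j).factorial : ℝ) :=
      prod_congr rfl fun j hj => by rw [hbj j (mem_erase.1 hj).1]
    rw [this]
    push_cast
    ring
  have hpos : ∀ j < k, (0 : ℝ) < lam.part j := fun j hj =>
    Nat.cast_pos.2 (Nat.pos_of_ne_zero ((lam.part_ne_zero_iff j).2 hj))
  have hne : ∏ j ∈ (range k).erase i,
      (((lam.part i : ℝ) - lam.part j) / (lam.part i + lam.part j)) ≠ 0 :=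
    prod_ne_zero_iff.2 fun j hj => by
      rw [mem_erase, mem_range] at hj
      have := hpos i hi
      have := hpos j hj.2
      exact div_ne_zero (lam.part_sub_part_ne_zero hj.1.symm hi) (by positivity)
  have hcoef : partialFractionCoeff (range k) (fun j => (lam.part j : ℝ) * (lam.part j - 1))
      (fun j => 2 * (lam.part j : ℝ)) i / 2 = lam.part i *
      ((∏ j ∈ (range k).erase i, (((mu.part i : ℝ) - lam.part j) / (mu.part i + lam.part j))) /
        ∏ j ∈ (range k).erase i, (((lam.part i : ℝ) - lam.part j) / (lam.part i + lam.part j))) := by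
    rw [partialFractionCoeff, ← prod_div_distrib, mul_assoc, mul_div_cancel_left₀ _ two_ne_zero]
    congr 1
    refine prod_congr rfl fun j hj => ?_
    rw [mem_erase, mem_range] at hj
    have h1 := lam.part_sub_part_ne_zero hj.1.symm hi
    have h2 := lam.part_mul_pred_sub_ne_zero hj.1.symm hi hj.2
    have h3 := hpos j hj.2
    rw [hbi] at h1 h2 ⊢
    push_cast at h1 h2 ⊢
    have h4 : (mu.part i : ℝ) + lam.part j ≠ 0 := by positivity
    have h5 : (mu.part i : ℝ) + 1 + lam.part j ≠ 0 := by positivity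
    field_simp
    ring
  have hb0 : (lam.part i : ℝ) ≠ 0 := (hpos i hi).ne'
  have hf0 : ∏ j ∈ range k, ((mu.part j).factorial : ℝ) ≠ 0 := by positivity
  have hc0 : (mu.weight : ℝ) + 1 ≠ 0 := by positivity
  rw [schurDim, schurDim, hcoef, hfac, hcard, Nat.factorial_succ]
  rw [mul_comm] at hD
  generalize (∏ j ∈ (range k).erase i,
    (((lam.part i : ℝ) - lam.part j) / (lam.part i + lam.part j))) = A at *
  generalize (∏ j ∈ (range k).erase i,
    (((mu.part i : ℝ) - lam.part j) / (mu.part i + lam.part j))) = B at *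
  push_cast
  field_simp
  linear_combination hD

/-- The recursion reduces to the sum of the partial fraction coefficients being ∑ 2λ_j = 2|λ|. -/
theorem dim_eq_schurDim (lam : StrictPartition) : (lam.dim : ℝ) = schurDim lam.length lam := by
  classical
  have hempty : StrictPartition.empty.length = 0 := rfl
  refine (GraphPath.finite_and_card (E := Covers) weight (fun c b h => ?_) (fun c h => ?_)
    (fun _ => True) (fun lam => schurDim lam.length lam) ?_ (fun lam _ hne => ?_) lam trivial).2
  · have := h.2
    omega
  · have := h.2
    change 0 = _ at this
    omega
  · rw [hempty]
    simp [schurDim, pairProd, weight, StrictPartition.empty]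
  · set k := lam.length with hk
    -- A box can leave row `i` if the next row is shorter by at least two, or if the row is a single
    -- box and disappears.
    set I := (range k).filter fun i => lam.part (i + 1) + 1 < lam.part i ∨ lam.part i = 1 with hI
    have hex : ∀ i ∈ I, ∃ mu : StrictPartition,
        ∀ j, lam.part j = mu.part j + if j = i then 1 else 0 := by
      intro i hi
      rw [hI, mem_filter, mem_range] at hi
      have hi0 := (lam.part_ne_zero_iff i).2 hi.1
      obtain ⟨mu, hmu⟩ := exists_part_eq (fun j => lam.part j - if j = i then 1 else 0) k
        (fun j hj => by
          have h1 := lam.part_succ_lt j (by omega)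
          by_cases hji : j = i
          · subst hji
            simp only [Nat.succ_ne_self, if_true, if_false] at hj ⊢
            omega
          · simp only [if_neg hji]
            omega)
        (fun j hj => by
          have h1 := lam.antitone (Nat.le_succ j)
          by_cases hji : j = i
          · subst hji
            simp only [Nat.succ_ne_self, if_true, if_false, Nat.succ_eq_add_one] at hj h1 ⊢
            have := lam.part_succ_lt j hi0
            omega
          · simp only [if_neg hji, Nat.succ_eq_add_one] at hj h1 ⊢
            omega)
        (fun j hj => by
          rw [lam.part_eq_zero hj, Nat.zero_sub])
      refine ⟨mu, fun j => ?_⟩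
      rw [hmu]
      split_ifs with hj
      · subst hj
        omega
      · rfl
    have : Nonempty StrictPartition := ⟨lam⟩
    choose! pred hpred using hex
    have hinj : Set.InjOn pred I := by
      intro a ha b hb hab
      have h1 := hpred a ha a
      have h2 := hpred b hb a
      rw [hab, if_pos rfl] at h1
      by_contra hne
      rw [if_neg hne] at h2
      omega
    refine ⟨I.image pred, fun mu => ?_, fun _ _ => trivial, ?_⟩
    · rw [mem_image]
      constructor
      · rintro ⟨i, hi, rfl⟩
        exact covers_of_part (hpred i hi)
      · intro h
        obtain ⟨i, hi⟩ := h.exists_part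
        have hiI : i ∈ I := by
          have h1 := hi i
          have h2 := hi (i + 1)
          have h3 := mu.part_succ_lt i
          have h4 := mu.antitone (Nat.le_succ i)
          simp only [if_true, Nat.succ_ne_self, Nat.succ_eq_add_one, if_false] at h1 h2 h3 h4
          rw [hI, mem_filter, mem_range]
          exact ⟨lt_length_of_part hi, by omega⟩
        refine ⟨i, hiI, ext_part fun j => ?_⟩
        have h1 := hi j
        have h2 := hpred i hiI j
        omega
    · have hc0 : (lam.weight : ℝ) ≠ 0 := by
        rw [Nat.cast_ne_zero]
        intro h
        apply hne
        refine ext_part fun i => ?_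
        by_contra hi
        have hi' := (lam.part_ne_zero_iff i).1 hi
        rw [weight_eq_sum] at h
        exact hi (sum_eq_zero_iff.1 h i (mem_range.2 hi'))
      have hinjx : Set.InjOn (fun j => (lam.part j : ℝ) * (lam.part j - 1)) (range k) := by
        intro a ha b hb hab
        by_contra hne
        exact lam.part_mul_pred_sub_ne_zero hne (by simpa using ha) (by simpa using hb)
          (sub_eq_zero.2 hab)
      have hsum := sum_partialFractionCoeff (range k)
        (fun j => (lam.part j : ℝ) * (lam.part j - 1)) (fun j => 2 * (lam.part j : ℝ)) hinjx
      rw [sum_image hinj, sum_congr rfl fun i hi => schurDim_of_covers (hpred i hi),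
        ← mul_sum, ← sum_div, sum_filter_of_ne]
      · rw [hsum, ← mul_sum, mul_div_cancel_left₀ _ two_ne_zero, ← Nat.cast_sum, hk,
          ← weight_eq_sum]
        field_simp
      · intro i hi hne
        rw [mem_range] at hi
        by_contra hlt
        rw [not_or] at hlt
        apply hne
        have h0 := (lam.part_ne_zero_iff i).2 hi
        have h1 := lam.part_succ_lt i h0
        have h2 : lam.part i = lam.part (i + 1) + 1 := by omega
        have h3 : lam.part (i + 1) ≠ 0 := by omega
        have h4 : i + 1 < k := (lam.part_ne_zero_iff _).1 h3
        -- Here λ_i = λ_{i+1} + 1, so x_i - x_{i+1} = 2λ_{i+1} and the factor of index `i + 1`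
        -- vanishes.
        rw [partialFractionCoeff, prod_eq_zero (i := i + 1), mul_zero]
        · simpa using h4
        · have h5 : (lam.part (i + 1) : ℝ) ≠ 0 := Nat.cast_ne_zero.2 h3
          rw [h2]
          push_cast
          have e : ((lam.part (i + 1) : ℝ) + 1) * (lam.part (i + 1) + 1 - 1) -
            lam.part (i + 1) * (lam.part (i + 1) - 1) = 2 * lam.part (i + 1) := by ring
          rw [e, div_self (by positivity), sub_self]

/-- The transition probability as a residue, in terms of the parts. -/
theorem plancherelUp_eq {mu lam : StrictPartition} {i : ℕ}
    (h : ∀ j, lam.part j = mu.part j + if j = i then 1 else 0) :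
    mu.plancherelUp lam =
      (∏ j ∈ range mu.length,
        ((mu.part i : ℝ) * (mu.part i + 1) - mu.part j * (mu.part j - 1))) /
      ∏ j ∈ (range (mu.length + 1)).erase i,
        ((mu.part i : ℝ) * (mu.part i + 1) - mu.part j * (mu.part j + 1)) := by
  have hcov := covers_of_part h
  have hs0 := schurDim_ne_zero mu
  have hr0 := schurDim_ne_zero lam
  have hstep := schurDim_of_covers h
  have hc0 : (mu.weight : ℝ) + 1 ≠ 0 := by positivity
  have hf0 : (mu.weight.factorial : ℝ) ≠ 0 := by positivity
  have hi := lt_length_of_part h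
  have hbi : lam.part i = mu.part i + 1 := by simp [h]
  have hbj : ∀ j, j ≠ i → lam.part j = mu.part j := fun j hj => by simp [h, hj]
  have e1 : mu.plancherelUp lam = (2 : ℝ) ^ ((1 : ℤ) + mu.length - lam.length) *
      (schurDim lam.length lam / (schurDim mu.length mu * (mu.weight + 1))) := by
    rw [plancherelUp, upProb, if_pos hcov, downProb, if_pos hcov]
    change (mu.dim : ℝ) / (lam.dim : ℝ) * lam.plancherel / mu.plancherel = _
    rw [plancherel, plancherel, dim_eq_schurDim, dim_eq_schurDim, hcov.2, Nat.factorial_succ]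
    have e : ((mu.weight + 1 : ℕ) : ℤ) - lam.length =
      (1 + mu.length - lam.length) + ((mu.weight : ℤ) - mu.length) := by push_cast; ring
    rw [e, zpow_add₀ two_ne_zero]
    have : (2 : ℝ) ^ ((mu.weight : ℤ) - mu.length) ≠ 0 := by positivity
    push_cast
    field_simp
  have e2 : partialFractionCoeff (range lam.length) (fun j => (lam.part j : ℝ) * (lam.part j - 1))
        (fun j => 2 * (lam.part j : ℝ)) i / 2 =
      (mu.part i + 1) * ((∏ j ∈ (range lam.length).erase i,
        ((mu.part i : ℝ) * (mu.part i + 1) - mu.part j * (mu.part j + 1))) /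
      ∏ j ∈ (range lam.length).erase i,
        ((mu.part i : ℝ) * (mu.part i + 1) - mu.part j * (mu.part j - 1))) := by
    rw [partialFractionCoeff, ← prod_div_distrib, mul_assoc, mul_div_cancel_left₀ _ two_ne_zero, hbi]
    push_cast
    congr 1
    refine prod_congr rfl fun j hj => ?_
    have hj' := mem_erase.1 hj
    have hne := lam.part_mul_pred_sub_ne_zero hj'.1.symm hi (mem_range.1 hj'.2)
    rw [hbj j hj'.1, hbi] at hne
    rw [hbj j hj'.1]
    push_cast at hne
    rw [add_sub_cancel_right, mul_comm ((mu.part i : ℝ) + 1)] at hne ⊢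
    rw [one_sub_div hne]
    congr 1
    ring
  rw [hcov.2, e2] at hstep
  rw [e1]
  have hm0 : (mu.part i : ℝ) + 1 ≠ 0 := by positivity
  set A := ∏ j ∈ (range lam.length).erase i,
        ((mu.part i : ℝ) * (mu.part i + 1) - mu.part j * (mu.part j + 1)) with hA
  set B := ∏ j ∈ (range lam.length).erase i,
        ((mu.part i : ℝ) * (mu.part i + 1) - mu.part j * (mu.part j - 1)) with hB
  have hA0 : A ≠ 0 := by
    intro h0
    rw [h0] at hstep
    simp only [zero_div, mul_zero] at hstep
    exact hs0 hstep
  have hB0 : B ≠ 0 := by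
    intro h0
    rw [h0] at hstep
    simp only [div_zero, mul_zero] at hstep
    exact hs0 hstep
  have e3 : schurDim lam.length lam / (schurDim mu.length mu * (mu.weight + 1)) =
      B / ((mu.part i + 1) * A) := by
    rw [hstep]
    push_cast
    field_simp
  rw [e3]
  -- The power of 2 is 1 for a new row and 2 otherwise. In the second case the extra factors on the
  -- right are 2μ_i (numerator, j = i) and μ_i(μ_i + 1) (denominator, j = ℓ(μ)), which supply the 2
  -- and the 1/(μ_i + 1).
  by_cases hz : mu.part i = 0
  · obtain ⟨h1, h2⟩ := length_of_part_eq_zero h hz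
    have h3 : (range lam.length).erase i = range mu.length := by
      rw [h2, h1, range_add_one, erase_insert (by simp)]
    have h4 : (1 : ℤ) + mu.length - lam.length = 0 := by rw [h2]; push_cast; ring
    rw [h4, hA, hB, ← h2, h3, hz]
    simp
  · obtain ⟨h1, h2⟩ := length_of_part_ne_zero h hz
    have h4 : (1 : ℤ) + mu.length - lam.length = 1 := by rw [h2]; ring
    have him : i ∈ range lam.length := mem_range.2 hi
    have h5 : (mu.part i : ℝ) ≠ 0 := Nat.cast_ne_zero.2 hz
    have h6 : mu.length ∉ (range mu.length).erase i := by simp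
    rw [h4, ← h2, range_add_one, erase_insert_of_ne (by omega), prod_insert (h2 ▸ h6),
      ← mul_prod_erase _ _ him, ← hA, ← hB, h2, mu.part_eq_zero le_rfl]
    simp only [Nat.cast_zero, zero_mul, sub_zero, zpow_one]
    have e : (mu.part i : ℝ) * (mu.part i + 1) - mu.part i * (mu.part i - 1) = 2 * mu.part i := by
      ring
    rw [e]
    field_simp

end StrictPartition

/-! ### Products over boxes -/

/-- The contribution of a box of content `c` to the rational function of a diagram. -/
noncomputable def contentFactor {K : Type*} [Field K] (z c : K) : K :=
  (z - c) ^ 2 / ((z - c - 1) * (z - c + 1))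

section
variable {K : Type*} [Field K] {z : K}

/-- Every denominator below is z minus an integer. Stating the identities at a non-integral point of
an arbitrary field lets them serve both the variable of ℂ(u) and real points near a pole. -/
theorem sub_intCast_ne_zero (hz : ∀ n : ℤ, z ≠ n) (n : ℤ) (w : K) (hw : w = z - n) : w ≠ 0 :=
  hw ▸ sub_ne_zero.2 (hz n)

theorem prod_contentFactor_row (hz : ∀ n : ℤ, z ≠ n) (i r : ℕ) :
    ∏ j ∈ range r, contentFactor z ((j : K) - i) =
      (z + i) / (z + (i + 1 : ℕ)) * ((z - (r - i) + 1) / (z - (r - i))) := by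
  have h := sub_intCast_ne_zero hz
  induction r with
  | zero =>
    have h1 := h (-i) (z + i) (by push_cast; ring)
    have h2 := h (-i - 1) (z + (i + 1)) (by push_cast; ring)
    have h3 := h (-i) (z - (0 - i)) (by push_cast; ring)
    simp only [range_zero, prod_empty]
    push_cast
    field_simp
    ring
  | succ r ih =>
    have h1 := h (-i - 1) (z + (i + 1)) (by push_cast; ring)
    have h2 := h (r - i) (z - (r - i)) (by push_cast; ring)
    have h3 := h (r - i - 1) (z - (r - i) + 1) (by push_cast; ring)
    have h4 := h (r - i + 1) (z - (r - i) - 1) (by push_cast; ring)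
    have h5 := h (r - i + 1) (z - (r + 1 - i)) (by push_cast; ring)
    rw [prod_range_succ, ih, contentFactor]
    push_cast
    field_simp
    ring

theorem prod_add_div_add_succ (hz : ∀ n : ℤ, z ≠ n) (k : ℕ) :
    ∏ i ∈ range k, (z + i) / (z + (i + 1 : ℕ)) = z / (z + k) := by
  have h := sub_intCast_ne_zero hz
  have h0 := h 0 z (by simp)
  induction k with
  | zero => simp [h0]
  | succ k ih =>
    have h1 := h (-k) (z + k) (by push_cast; ring)
    rw [prod_range_succ, ih]
    field_simp

/-- A box of content c in a shifted row doubles to boxes of contents c + 1 and -c, and their joint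
contribution telescopes. The result is a function of z(z - 1), reflecting the symmetry z ↦ 1 - z,
which exchanges the two contents. -/
theorem prod_contentFactor_shifted_row (hz : ∀ n : ℤ, z ≠ n) (m : ℕ) :
    ∏ c ∈ range m, contentFactor z ((c : K) + 1) * contentFactor z (-(c : K)) =
      (z * (z - 1) - m * (m - 1)) / (z * (z - 1) - m * (m + 1)) := by
  have h := sub_intCast_ne_zero hz
  have e1 : ∀ x : K, z * (z - 1) - x * (x - 1) = (z + x - 1) * (z - x) := fun x => by ring
  have e2 : ∀ x : K, z * (z - 1) - x * (x + 1) = (z - x - 1) * (z + x) := fun x => by ring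
  simp only [e1, e2, contentFactor]
  induction m with
  | zero =>
    have h0 := h 0 z (by simp)
    have h1 := h 1 (z - 1) (by simp)
    simp
    field_simp
  | succ m ih =>
    have h1 := h (m + 1) (z - m - 1) (by push_cast; ring)
    have h2 := h (m + 2) (z - (m + 1) - 1) (by push_cast; ring)
    have h3 := h (-m) (z + m) (by push_cast; ring)
    have h4 := h (-m - 1) (z + (m + 1)) (by push_cast; ring)
    have h5 := h m (z - (m + 1) + 1) (by push_cast; ring)
    have h6 := h (1 - m) (z - (-m) - 1) (by push_cast; ring)
    have h7 := h (- m - 1) (z - (-m) + 1) (by push_cast; ring)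
    have h8 := h m (z - m) (by push_cast; ring)
    have h9 := h (1 - m) (z + m - 1) (by push_cast; ring)
    rw [prod_range_succ, ih]
    push_cast
    rw [show z - ((m : K) + 1) = z - m - 1 by ring] at h2 h5 ⊢
    rw [show z - m - 1 + 1 = z - m by ring] at h5 ⊢
    rw [show z - -(m : K) = z + m by ring] at h6 h7 ⊢
    rw [show z + ((m : K) + 1) = z + m + 1 by ring] at h4 ⊢
    rw [show z + (m : K) + 1 - 1 = z + m by ring]
    field_simp

end

/-! ### The rational function of an ordinary diagram -/

namespace YoungDiagram

/-- The rational function of a diagram in terms of its first `k` rows. -/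
noncomputable def rowRatio {K : Type*} [Field K] (ρ : YoungDiagram) (k : ℕ) (z : K) : K :=
  (∏ i ∈ range k, (z - ((ρ.rowLen i : K) - i) + 1)) /
    ∏ i ∈ range (k + 1), (z - ((ρ.rowLen i : K) - i))

theorem prod_contentFactor_eq {K : Type*} [Field K] {z : K} (hz : ∀ n : ℤ, z ≠ n)
    (ρ : YoungDiagram) (k : ℕ) (hk : ρ.rowLen k = 0) :
    ∏ b ∈ ρ.cells, contentFactor z ((boxContent b : ℤ) : K) = z * ρ.rowRatio k z := by
  rw [ρ.prod_cells k hk]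
  have h1 : ∀ i ∈ range k, ∏ j ∈ range (ρ.rowLen i),
      contentFactor z ((boxContent (i, j) : ℤ) : K) = (z + i) / (z + (i + 1 : ℕ)) *
        ((z - (ρ.rowLen i - i) + 1) / (z - (ρ.rowLen i - i))) := fun i _ => by
    rw [← prod_contentFactor_row hz]
    refine prod_congr rfl fun j _ => ?_
    simp [boxContent]
  -- The left ends of the rows telescope to z/(z + k), and z + k is the denominator factor of the
  -- empty row `k`.
  rw [prod_congr rfl h1, prod_mul_distrib, prod_add_div_add_succ hz, prod_div_distrib, rowRatio,
    prod_range_succ (fun i => z - ((ρ.rowLen i : K) - i)), hk, Nat.cast_zero, zero_sub,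
    sub_neg_eq_add]
  rw [div_mul_div_comm, mul_div_assoc', mul_comm (z + k)]

theorem removable_toFinset (ρ : YoungDiagram) (k : ℕ) (hk : ρ.rowLen k = 0) :
    ρ.removable_finite.toFinset =
      ((range k).filter fun i => ¬ ρ.rowLen (i + 1) = ρ.rowLen i).image
        fun i => (i, ρ.rowLen i - 1) := by
  ext ⟨a, b⟩
  rw [Set.Finite.mem_toFinset, mem_image]
  constructor
  · rintro ⟨σ, hσ, hb, hb'⟩
    obtain ⟨i, hi⟩ := hσ.exists_rowLen
    obtain ⟨_, hc⟩ := cells_eq_insert_of_rowLen hi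
    rw [← mem_cells, hc, mem_insert] at hb
    obtain ⟨rfl, rfl⟩ := Prod.mk.inj (hb.resolve_right hb')
    have h1 := hi a
    have h2 := hi (a + 1)
    have h3 := σ.rowLen_antitone (Nat.le_succ a)
    simp only [if_true, Nat.succ_ne_self, Nat.succ_eq_add_one, if_false] at h1 h2 h3
    refine ⟨a, ?_, ?_⟩
    · rw [mem_filter, mem_range]
      refine ⟨?_, by omega⟩
      by_contra hak
      have := ρ.rowLen_antitone (not_lt.1 hak)
      omega
    · rw [h1, Nat.add_sub_cancel]
  · rintro ⟨i, hi, he⟩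
    obtain ⟨rfl, rfl⟩ := Prod.mk.inj he
    rw [mem_filter, mem_range] at hi
    have h0 := ρ.rowLen_antitone (Nat.le_succ i)
    obtain ⟨σ, hσ⟩ := exists_rowLen_eq (fun j => ρ.rowLen j - if j = i then 1 else 0)
      (antitone_nat_of_succ_le fun j => by
        have := ρ.rowLen_antitone (Nat.le_succ j)
        by_cases hj : j = i
        · subst hj
          simp only [Nat.succ_ne_self, if_true, if_false, Nat.succ_eq_add_one] at this ⊢
          omega
        · simp only [if_neg hj]
          exact (Nat.sub_le _ _).trans this) k (by simp [hk])
    have hσ' : ∀ j, ρ.rowLen j = σ.rowLen j + if j = i then 1 else 0 := fun j => by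
      rw [hσ]
      split_ifs with hj
      · subst hj
        simp only [Nat.succ_eq_add_one] at h0
        omega
      · rfl
    obtain ⟨h1, h2⟩ := cells_eq_insert_of_rowLen hσ'
    have h3 : σ.rowLen i = ρ.rowLen i - 1 := by rw [hσ, if_pos rfl]
    rw [h3] at h1 h2
    exact ⟨σ, covers_of_rowLen hσ', (mem_cells _).1 (h2 ▸ mem_insert_self _ _), h1⟩

theorem addable_toFinset (ρ : YoungDiagram) (k : ℕ) (hk : ρ.rowLen k = 0) :
    ρ.addable_finite.toFinset =
      ((range (k + 1)).filter fun i => i = 0 ∨ ¬ ρ.rowLen (i - 1 + 1) = ρ.rowLen (i - 1)).image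
        fun i => (i, ρ.rowLen i) := by
  ext ⟨a, b⟩
  rw [Set.Finite.mem_toFinset, mem_image]
  constructor
  · rintro ⟨τ, hτ, hb, hb'⟩
    obtain ⟨i, hi⟩ := hτ.exists_rowLen
    obtain ⟨_, hc⟩ := cells_eq_insert_of_rowLen hi
    rw [← mem_cells, hc, mem_insert] at hb
    obtain ⟨rfl, rfl⟩ := Prod.mk.inj (hb.resolve_right hb')
    refine ⟨a, ?_, rfl⟩
    rw [mem_filter, mem_range]
    rcases Nat.eq_zero_or_pos a with rfl | ha
    · exact ⟨Nat.succ_pos _, Or.inl rfl⟩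
    · have h1 := hi a
      have h2 := hi (a - 1)
      have h3 := τ.rowLen_antitone (Nat.sub_le a 1)
      rw [if_pos rfl] at h1
      rw [if_neg (by omega)] at h2
      rw [Nat.sub_add_cancel ha]
      refine ⟨?_, Or.inr (by omega)⟩
      by_contra hak
      have := ρ.rowLen_antitone (show k ≤ a - 1 by omega)
      omega
  · rintro ⟨i, hi, he⟩
    obtain ⟨rfl, rfl⟩ := Prod.mk.inj he
    rw [mem_filter, mem_range] at hi
    obtain ⟨τ, hτ⟩ := exists_rowLen_eq (fun j => ρ.rowLen j + if j = i then 1 else 0)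
      (antitone_nat_of_succ_le fun j => by
        have := ρ.rowLen_antitone (Nat.le_succ j)
        by_cases hj : j + 1 = i
        · subst hj
          have h2 := hi.2
          simp only [Nat.add_sub_cancel, Nat.add_eq_zero_iff, one_ne_zero, and_false,
            false_or] at h2
          simp only [if_true, if_neg (Nat.succ_ne_self j).symm, Nat.succ_eq_add_one] at this ⊢
          omega
        · simp only [if_neg hj, Nat.succ_eq_add_one] at this ⊢
          omega) (k + 1) (by
        have := ρ.rowLen_antitone (Nat.le_succ k)
        simp only [Nat.succ_eq_add_one] at this
        simp only [if_neg hi.1.ne']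
        omega)
    obtain ⟨h1, h2⟩ := cells_eq_insert_of_rowLen hτ
    exact ⟨τ, covers_of_rowLen hτ, (mem_cells _).1 (h2 ▸ mem_insert_self _ _), h1⟩

theorem _root_.RatFunc.X_sub_C_ne_zero (c : ℂ) : (RatFunc.X - RatFunc.C c : RatFunc ℂ) ≠ 0 := by
  rw [← RatFunc.algebraMap_X, ← RatFunc.algebraMap_C, ← map_sub]
  exact RatFunc.algebraMap_ne_zero (Polynomial.X_sub_C_ne_zero c)

/-- Summing up corners or all rows makes no difference: for rows `i`, `i + 1` of equal length, the
end of row `i` has the content of the first free place of row `i + 1`, and the two factors cancel.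
-/
theorem kerovR_eq (ρ : YoungDiagram) (k : ℕ) (hk : ρ.rowLen k = 0) :
    ρ.kerovR = ρ.rowRatio k (RatFunc.X : RatFunc ℂ) := by
  have h := prod_filter_corner (fun i => ρ.rowLen (i + 1) = ρ.rowLen i)
    (fun i => (RatFunc.X : RatFunc ℂ) - ((ρ.rowLen i : RatFunc ℂ) - i) + 1)
    (fun i => (RatFunc.X : RatFunc ℂ) - ((ρ.rowLen i : RatFunc ℂ) - i)) k (fun i _ hS => by
      simp only [hS]
      push_cast
      ring)
  rw [kerovR, rowRatio, ρ.removable_toFinset k hk, ρ.addable_toFinset k hk, prod_image, prod_image]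
  · have e1 : ∀ i, (RatFunc.X - RatFunc.C ((boxContent (i, ρ.rowLen i) : ℤ) : ℂ) : RatFunc ℂ) =
        (RatFunc.X : RatFunc ℂ) - ((ρ.rowLen i : RatFunc ℂ) - i) := fun i => by
      simp [boxContent]
    have e2 : ∏ i ∈ range k with ¬ ρ.rowLen (i + 1) = ρ.rowLen i,
        (RatFunc.X - RatFunc.C ((boxContent (i, ρ.rowLen i - 1) : ℤ) : ℂ) : RatFunc ℂ) =
        ∏ i ∈ range k with ¬ ρ.rowLen (i + 1) = ρ.rowLen i,
          ((RatFunc.X : RatFunc ℂ) - ((ρ.rowLen i : RatFunc ℂ) - i) + 1) := by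
      refine prod_congr rfl fun i hi => ?_
      have h1 := (mem_filter.1 hi).2
      have h2 := ρ.rowLen_antitone (Nat.le_succ i)
      simp only [Nat.succ_eq_add_one] at h2
      have h3 : 1 ≤ ρ.rowLen i := by omega
      simp only [boxContent, Nat.cast_sub h3]
      push_cast
      simp
      ring
    rw [e2, prod_congr rfl fun i _ => e1 i, div_eq_div_iff, ← h]
    · exact prod_ne_zero_iff.2 fun i _ => e1 i ▸ RatFunc.X_sub_C_ne_zero _
    · exact prod_ne_zero_iff.2 fun i _ => e1 i ▸ RatFunc.X_sub_C_ne_zero _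
  · exact fun a _ b _ hab => congrArg Prod.fst hab
  · exact fun a _ b _ hab => congrArg Prod.fst hab

end YoungDiagram

/-! ### Substitution v = u(u - 1) and the doubling -/

/-- Evaluation is defined through the reduced fraction. The reduced denominator divides `q`, so it
does not vanish at `a` either, and any representation may be used. -/
theorem RatFunc.eval_algebraMap_div.{u} {K L : Type u} [Field K] [Field L] (f : K →+* L) (a : L)
    (p q : Polynomial K) (hq : Polynomial.eval₂ f a q ≠ 0) :
    RatFunc.eval f a (algebraMap (Polynomial K) (RatFunc K) p / algebraMap _ _ q) =
      Polynomial.eval₂ f a p / Polynomial.eval₂ f a q := by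
  have hq0 : q ≠ 0 := by
    rintro rfl
    simp at hq
  set x := algebraMap (Polynomial K) (RatFunc K) p / algebraMap _ _ q with hx
  have h1 := congrArg (Polynomial.eval₂ f a) ((RatFunc.num_mul_eq_mul_denom_iff hq0).2 hx)
  obtain ⟨d, hd⟩ := (RatFunc.denom_dvd hq0).2 ⟨p, hx⟩
  rw [Polynomial.eval₂_mul, Polynomial.eval₂_mul] at h1
  have h2 : Polynomial.eval₂ f a x.denom ≠ 0 := by
    intro h0
    apply hq
    rw [hd, Polynomial.eval₂_mul, h0, zero_mul]
  rw [RatFunc.eval, div_eq_div_iff h2 hq, h1]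

theorem RatFunc.X_ne_intCast (n : ℤ) : (RatFunc.X : RatFunc ℂ) ≠ n := by
  have := RatFunc.X_sub_C_ne_zero (n : ℂ)
  rw [map_intCast] at this
  exact sub_ne_zero.1 this

namespace StrictPartition

/-- The rational function of a strict partition in terms of its parts. -/
noncomputable def rowRatio {K : Type*} [Field K] (lam : StrictPartition) (v : K) : K :=
  (∏ i ∈ range lam.length, (v - lam.part i * (lam.part i - 1))) /
    ∏ i ∈ range (lam.length + 1), (v - lam.part i * (lam.part i + 1))

theorem removable_toFinset (lam : StrictPartition) :
    lam.removable_finite.toFinset =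
      ((range lam.length).filter
        fun i => ¬ (lam.part i = lam.part (i + 1) + 1 ∧ lam.part (i + 1) ≠ 0)).image
        fun i => (i, i + lam.part i - 1) := by
  ext ⟨a, b⟩
  rw [Set.Finite.mem_toFinset, mem_image]
  constructor
  · rintro ⟨mu, hmu, hb, hb'⟩
    obtain ⟨i, hi⟩ := hmu.exists_part
    obtain ⟨_, hc⟩ := cells_eq_insert_of_part hi
    rw [hc, mem_insert] at hb
    obtain ⟨rfl, rfl⟩ := Prod.mk.inj (hb.resolve_right hb')
    have h1 := hi a
    have h2 := hi (a + 1)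
    have h3 := mu.part_succ_lt a
    have h4 := mu.antitone (Nat.le_succ a)
    simp only [if_true, Nat.succ_ne_self, Nat.succ_eq_add_one, if_false] at h1 h2 h3 h4
    refine ⟨a, ?_, ?_⟩
    · rw [mem_filter, mem_range]
      exact ⟨lt_length_of_part hi, by omega⟩
    · rw [h1, ← Nat.add_assoc, Nat.add_sub_cancel]
  · rintro ⟨i, hi, he⟩
    obtain ⟨rfl, rfl⟩ := Prod.mk.inj he
    rw [mem_filter, mem_range] at hi
    have hi0 := (lam.part_ne_zero_iff i).2 hi.1
    have hi1 := lam.part_succ_lt i hi0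
    obtain ⟨mu, hmu⟩ := exists_part_eq (fun j => lam.part j - if j = i then 1 else 0) lam.length
      (fun j hj => by
        have h1 := lam.part_succ_lt j (by omega)
        by_cases hji : j = i
        · subst hji
          simp only [Nat.succ_ne_self, if_true, if_false] at hj ⊢
          omega
        · simp only [if_neg hji]
          omega)
      (fun j hj => by
        have h1 := lam.antitone (Nat.le_succ j)
        by_cases hji : j = i
        · subst hji
          simp only [Nat.succ_ne_self, if_true, if_false, Nat.succ_eq_add_one] at hj h1 ⊢
          omega
        · simp only [if_neg hji, Nat.succ_eq_add_one] at hj h1 ⊢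
          omega)
      (fun j hj => by
        rw [lam.part_eq_zero hj, Nat.zero_sub])
    have hmu' : ∀ j, lam.part j = mu.part j + if j = i then 1 else 0 := fun j => by
      rw [hmu]
      split_ifs with hj
      · subst hj
        omega
      · rfl
    obtain ⟨h1, h2⟩ := cells_eq_insert_of_part hmu'
    have h3 : i + mu.part i = i + lam.part i - 1 := by rw [hmu' i, if_pos rfl]; omega
    rw [h3] at h1 h2
    exact ⟨mu, covers_of_part hmu', h2 ▸ mem_insert_self _ _, h1⟩

theorem addable_toFinset_filter (lam : StrictPartition)
    [DecidablePred fun b : ℕ × ℕ => boxContent b ≠ 0] :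
    (lam.addable_finite.toFinset.filter fun b => boxContent b ≠ 0) =
      ((range lam.length).filter fun i => i = 0 ∨
        ¬ (lam.part (i - 1) = lam.part (i - 1 + 1) + 1 ∧ lam.part (i - 1 + 1) ≠ 0)).image
        fun i => (i, i + lam.part i) := by
  ext ⟨a, b⟩
  rw [mem_filter, Set.Finite.mem_toFinset, mem_image]
  constructor
  · rintro ⟨⟨nu, hnu, hb, hb'⟩, hcont⟩
    obtain ⟨i, hi⟩ := hnu.exists_part
    obtain ⟨_, hc⟩ := cells_eq_insert_of_part hi
    rw [hc, mem_insert] at hb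
    obtain ⟨rfl, rfl⟩ := Prod.mk.inj (hb.resolve_right hb')
    have h0 : lam.part a ≠ 0 := by
      intro h0
      apply hcont
      simp [boxContent, h0]
    refine ⟨a, ?_, rfl⟩
    rw [mem_filter, mem_range]
    refine ⟨(lam.part_ne_zero_iff a).1 h0, ?_⟩
    rcases Nat.eq_zero_or_pos a with rfl | ha
    · exact Or.inl rfl
    · have h1 := hi a
      have h2 := hi (a - 1)
      rw [if_pos rfl] at h1
      rw [if_neg (by omega)] at h2
      have h3 := nu.part_lt_part (i := a - 1) (j := a) (by omega)
        (by have := lt_length_of_part hi; omega)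
      rw [Nat.sub_add_cancel ha]
      exact Or.inr (by omega)
  · rintro ⟨i, hi, he⟩
    obtain ⟨rfl, rfl⟩ := Prod.mk.inj he
    rw [mem_filter, mem_range] at hi
    have hi0 := (lam.part_ne_zero_iff i).2 hi.1
    obtain ⟨nu, hnu⟩ := exists_part_eq (fun j => lam.part j + if j = i then 1 else 0) lam.length
      (fun j hj => by
        by_cases hji : j + 1 = i
        · subst hji
          have h2 := hi.2
          have h1 := lam.part_succ_lt j ((lam.part_ne_zero_iff j).2 (by omega))
          simp only [Nat.add_sub_cancel, Nat.add_eq_zero_iff, one_ne_zero, and_false,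
            false_or] at h2
          simp only [if_true, if_neg (Nat.succ_ne_self j).symm]
          omega
        · simp only [if_neg hji]
          have h1 := lam.part_succ_lt j (by
            intro h0
            simp only [h0] at hj
            split_ifs at hj with hji'
            · exact hi0 (hji' ▸ h0)
            · omega)
          omega)
      (fun j hj => by
        have h1 := lam.antitone (Nat.le_succ j)
        simp only [Nat.succ_eq_add_one] at h1
        by_cases hji : j + 1 = i
        · subst hji
          omega
        · simp only [if_neg hji]
          omega)
      (fun j hj => by
        rw [lam.part_eq_zero hj, if_neg (by omega)])
    obtain ⟨h1, h2⟩ := cells_eq_insert_of_part hnu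
    refine ⟨⟨nu, covers_of_part hnu, h2 ▸ mem_insert_self _ _, h1⟩, ?_⟩
    simpa [boxContent] using hi0

/-- The corner cancellation is carried out after the substitution, where no denominator vanishes
because v - m(m + 1) = (X - (m + 1))(X + m). -/
theorem eval_kerovR (lam : StrictPartition) :
    RatFunc.eval (RatFunc.C : ℂ →+* RatFunc ℂ) (RatFunc.X * (RatFunc.X - 1)) lam.kerovR =
      lam.rowRatio (RatFunc.X * (RatFunc.X - 1) : RatFunc ℂ) := by
  set S : ℕ → Prop := fun i => lam.part i = lam.part (i + 1) + 1 ∧ lam.part (i + 1) ≠ 0 with hS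
  set v : RatFunc ℂ := RatFunc.X * (RatFunc.X - 1) with hv
  have hne : ∀ m : ℕ, v - (m : RatFunc ℂ) * ((m : RatFunc ℂ) + 1) ≠ 0 := fun m => by
    have e : v - (m : RatFunc ℂ) * ((m : RatFunc ℂ) + 1) = (RatFunc.X - ((m + 1 : ℤ) : RatFunc ℂ)) *
        (RatFunc.X - ((-m : ℤ) : RatFunc ℂ)) := by
      rw [hv]
      push_cast
      ring
    rw [e]
    exact mul_ne_zero (sub_ne_zero.2 (RatFunc.X_ne_intCast _))
      (sub_ne_zero.2 (RatFunc.X_ne_intCast _))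
  have h := prod_filter_corner S (fun i => v - (lam.part i : RatFunc ℂ) * (lam.part i - 1))
    (fun i => v - (lam.part i : RatFunc ℂ) * (lam.part i + 1)) lam.length (fun i _ hi => by
      simp only [hi.1]
      push_cast
      ring)
  -- The first empty row gives the separate factor v of the definition. The condition `lam.part (i +
  -- 1) ≠ 0` in `S` keeps this factor even when the last part is 1: no box can then be added on the
  -- diagonal, but the removable box of content 0 puts a v in the numerator.
  have htop : ∏ i ∈ range (lam.length + 1) with (i = 0 ∨ ¬ S (i - 1)),
      (v - (lam.part i : RatFunc ℂ) * (lam.part i + 1)) =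
      v * ∏ i ∈ range lam.length with (i = 0 ∨ ¬ S (i - 1)),
      (v - (lam.part i : RatFunc ℂ) * (lam.part i + 1)) := by
    have hlast : lam.length = 0 ∨ ¬ S (lam.length - 1) := by
      rcases Nat.eq_zero_or_pos lam.length with h0 | h0
      · exact Or.inl h0
      · refine Or.inr fun hs => hs.2 (lam.part_eq_zero (by omega))
    rw [range_add_one, filter_insert, if_pos hlast, prod_insert (by simp),
      lam.part_eq_zero le_rfl]
    simp
  rw [htop] at h
  rw [kerovR, lam.removable_toFinset, addable_toFinset_filter, prod_image, prod_image]
  · set p : Polynomial ℂ := ∏ i ∈ range lam.length with ¬ S i,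
      (Polynomial.X - Polynomial.C (((boxContent (i, i + lam.part i - 1) : ℤ) : ℂ) *
        (((boxContent (i, i + lam.part i - 1) : ℤ) : ℂ) + 1))) with hp
    set q : Polynomial ℂ := Polynomial.X * ∏ i ∈ range lam.length with (i = 0 ∨ ¬ S (i - 1)),
      (Polynomial.X - Polynomial.C (((boxContent (i, i + lam.part i) : ℤ) : ℂ) *
        (((boxContent (i, i + lam.part i) : ℤ) : ℂ) + 1))) with hq
    have ep : Polynomial.eval₂ (RatFunc.C : ℂ →+* RatFunc ℂ) v p =
        ∏ i ∈ range lam.length with ¬ S i, (v - (lam.part i : RatFunc ℂ) * (lam.part i - 1)) := by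
      rw [hp, Polynomial.eval₂_finsetProd]
      refine prod_congr rfl fun i hi => ?_
      have h0 := (lam.part_ne_zero_iff i).2 (mem_range.1 (mem_filter.1 hi).1)
      have hb : boxContent (i, i + lam.part i - 1) = (lam.part i : ℤ) - 1 := by
        simp only [boxContent]
        omega
      rw [hb]
      simp
      ring
    have eq : Polynomial.eval₂ (RatFunc.C : ℂ →+* RatFunc ℂ) v q =
        v * ∏ i ∈ range lam.length with (i = 0 ∨ ¬ S (i - 1)),
          (v - (lam.part i : RatFunc ℂ) * (lam.part i + 1)) := by
      rw [hq, Polynomial.eval₂_mul, Polynomial.eval₂_X, Polynomial.eval₂_finsetProd]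
      congr 1
      refine prod_congr rfl fun i hi => ?_
      simp [boxContent]
    have hv0 : v ≠ 0 := by simpa using hne 0
    have hq0 : Polynomial.eval₂ (RatFunc.C : ℂ →+* RatFunc ℂ) v q ≠ 0 := by
      rw [eq]
      exact mul_ne_zero hv0 (prod_ne_zero_iff.2 fun i _ => hne _)
    have key := RatFunc.eval_algebraMap_div (RatFunc.C : ℂ →+* RatFunc ℂ) v p q hq0
    rw [ep, eq] at key
    have hfin : (∏ i ∈ range lam.length with ¬ S i,
          (v - (lam.part i : RatFunc ℂ) * (lam.part i - 1))) /
        (v * ∏ i ∈ range lam.length with (i = 0 ∨ ¬ S (i - 1)),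
          (v - (lam.part i : RatFunc ℂ) * (lam.part i + 1))) = lam.rowRatio v := by
      rw [rowRatio, div_eq_div_iff, h]
      · exact mul_ne_zero hv0 (prod_ne_zero_iff.2 fun i _ => hne _)
      · exact prod_ne_zero_iff.2 fun i _ => hne _
    rw [← hfin, ← key, hp, hq]
    simp only [map_mul, map_prod, map_sub, RatFunc.algebraMap_X, RatFunc.algebraMap_C]
    simp only [hS]
  · exact fun a _ b _ hab => congrArg Prod.fst hab
  · exact fun a _ b _ hab => congrArg Prod.fst hab

theorem mem_double_cells (lam : StrictPartition) (a b : ℕ) :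
    (a, b) ∈ lam.double.cells ↔
      (a < b ∧ b ≤ a + lam.part a) ∨ (b ≤ a ∧ a < b + lam.part b) := by
  change (a, b) ∈ lam.doubleCells ↔ _
  rw [mem_doubleCells]
  rcases lt_or_ge a b with h | h
  · rw [min_eq_left h.le]
    omega
  · rw [min_eq_right h]
    omega

/-- The doubling is the shifted diagram moved one column to the right, lying strictly above the
diagonal, together with its transpose on and below the diagonal. -/
theorem prod_double_cells {M : Type*} [CommMonoid M] (lam : StrictPartition) (f : ℕ × ℕ → M) :
    ∏ b ∈ lam.double.cells, f b = ∏ b ∈ lam.cells, f (b.1, b.2 + 1) * f (b.2, b.1) := by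
  rw [← prod_filter_mul_prod_filter_not lam.double.cells (fun b => b.1 < b.2), prod_mul_distrib]
  congr 1
  · refine prod_bij' (fun b _ => (b.1, b.2 - 1)) (fun b _ => (b.1, b.2 + 1)) ?_ ?_ ?_ ?_ ?_
    · rintro ⟨a, b⟩ h
      rw [mem_filter, mem_double_cells] at h
      change (a, b - 1) ∈ lam.cells
      rw [mem_cells]
      simp only at h
      omega
    · rintro ⟨a, b⟩ h
      rw [mem_cells] at h
      rw [mem_filter, mem_double_cells]
      simp only
      omega
    · rintro ⟨a, b⟩ h
      have h2 := (mem_filter.1 h).2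
      simp only [Prod.mk.injEq, true_and] at h2 ⊢
      omega
    · rintro ⟨a, b⟩ h
      rfl
    · rintro ⟨a, b⟩ h
      have h2 := (mem_filter.1 h).2
      simp only at h2 ⊢
      rw [Nat.sub_add_cancel (by omega)]
  · refine prod_bij' (fun b _ => (b.2, b.1)) (fun b _ => (b.2, b.1)) ?_ ?_ ?_ ?_ ?_
    · rintro ⟨a, b⟩ h
      rw [mem_filter, mem_double_cells] at h
      change (b, a) ∈ lam.cells
      rw [mem_cells]
      simp only at h
      omega
    · rintro ⟨a, b⟩ h
      rw [mem_cells] at h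
      rw [mem_filter, mem_double_cells]
      simp only
      omega
    · intros; rfl
    · intros; rfl
    · intros; rfl

theorem rowRatio_double {K : Type*} [Field K] {z : K} (hz : ∀ n : ℤ, z ≠ n)
    (lam : StrictPartition) (k : ℕ) (hk : lam.double.rowLen k = 0) :
    (z - 1) * lam.rowRatio (z * (z - 1)) = lam.double.rowRatio k z := by
  have h := YoungDiagram.prod_contentFactor_eq hz lam.double k hk
  have h0 := sub_intCast_ne_zero hz 0 z (by simp)
  have h1 := sub_intCast_ne_zero hz 1 (z - 1) (by simp)
  rw [prod_double_cells, prod_cells] at h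
  refine mul_left_cancel₀ h0 (Eq.trans ?_ h)
  have hrow : ∀ i ∈ range lam.length, ∏ c ∈ range (lam.part i),
      (contentFactor z ((boxContent (i, i + c + 1) : ℤ) : K) *
        contentFactor z ((boxContent (i + c, i) : ℤ) : K)) =
      (z * (z - 1) - lam.part i * (lam.part i - 1)) /
        (z * (z - 1) - lam.part i * (lam.part i + 1)) := fun i _ => by
    rw [← prod_contentFactor_shifted_row hz]
    refine prod_congr rfl fun c _ => ?_
    simp only [boxContent]
    push_cast
    congr 2 <;> ring
  rw [prod_congr rfl hrow, prod_div_distrib, rowRatio,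
    prod_range_succ (fun i => z * (z - 1) - (lam.part i : K) * (lam.part i + 1)),
    lam.part_eq_zero le_rfl]
  simp only [Nat.cast_zero, zero_mul, sub_zero]
  rw [← div_div]
  field_simp

theorem double_kerovR (lam : StrictPartition) :
    (RatFunc.X - 1) *
        RatFunc.eval (RatFunc.C : ℂ →+* RatFunc ℂ) (RatFunc.X * (RatFunc.X - 1)) lam.kerovR =
      lam.double.kerovR := by
  rw [eval_kerovR, lam.double.kerovR_eq _ lam.double.rowLen_colLen_zero]
  exact rowRatio_double RatFunc.X_ne_intCast lam _ lam.double.rowLen_colLen_zero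

end StrictPartition

/-! ### Transition probabilities as residues -/

theorem eventually_ne_intCast (n : ℤ) : ∀ᶠ z : ℝ in 𝓝[≠] (n : ℝ), ∀ k : ℤ, z ≠ k := by
  filter_upwards [self_mem_nhdsWithin,
    nhdsWithin_le_nhds (Metric.ball_mem_nhds (n : ℝ) one_pos)] with z hz hz1 k hk
  subst hk
  rw [Metric.mem_ball, Real.dist_eq, ← Int.cast_sub, ← Int.cast_abs, ← Int.cast_one,
    Int.cast_lt, Int.abs_lt_one_iff, sub_eq_zero] at hz1
  exact hz (by rw [hz1]; rfl)

namespace YoungDiagram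

/-- Of two boxes added together, `b` may come first as soon as it does not lie weakly south-east of
`b'`. -/
theorem exists_cells_eq_insert {σ τ : YoungDiagram} {b b' : ℕ × ℕ}
    (hτ : τ.cells = insert b (insert b' σ.cells)) (hb : ¬ b' ≤ b) :
    ∃ ρ : YoungDiagram, ρ.cells = insert b σ.cells := by
  refine ⟨⟨insert b σ.cells, ?_⟩, rfl⟩
  intro x y hyx hx
  rw [mem_coe, mem_insert] at hx ⊢
  rcases hx with rfl | hx
  · have hxτ : x ∈ τ.cells := hτ ▸ mem_insert_self _ _
    have hy : y ∈ τ.cells := τ.isLowerSet hyx hxτ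
    rw [hτ, mem_insert, mem_insert] at hy
    rcases hy with h | rfl | h
    · exact Or.inl h
    · exact absurd hyx hb
    · exact Or.inr h
  · exact Or.inr (σ.isLowerSet hyx hx)

theorem covers_and_covers_iff {σ τ : YoungDiagram} {b b' : ℕ × ℕ}
    (hτ : τ.cells = insert b (insert b' σ.cells)) (hb : b ∉ σ.cells) (hb' : b' ∉ σ.cells)
    (hne : b ≠ b') (ρ : YoungDiagram) :
    (σ.Covers ρ ∧ ρ.Covers τ) ↔ (ρ.cells = insert b σ.cells ∨ ρ.cells = insert b' σ.cells) := by
  constructor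
  · rintro ⟨h1, h2⟩
    obtain ⟨x, hx, he⟩ := h1.exists_insert
    have hxτ : x ∈ τ.cells := cells_subset_iff.2 h2.1 (he ▸ mem_insert_self _ _)
    rw [hτ, mem_insert, mem_insert] at hxτ
    rcases hxτ with rfl | rfl | h
    · exact Or.inl he
    · exact Or.inr he
    · exact absurd h hx
  · rintro (h | h)
    · refine ⟨covers_of_cells_eq_insert hb h, covers_of_cells_eq_insert (b := b') ?_ ?_⟩
      · rw [h, mem_insert, not_or]
        exact ⟨hne.symm, hb'⟩
      · rw [hτ, h, Finset.insert_comm]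
    · refine ⟨covers_of_cells_eq_insert hb' h, covers_of_cells_eq_insert (b := b) ?_ ?_⟩
      · rw [h, mem_insert, not_or]
        exact ⟨hne, hb⟩
      · rw [hτ, h]

/-- The residue at a simple pole, expressed as a limit. The numbers σ_j - j are strictly decreasing,
so only the denominator factor of the row of `b` vanishes at the content of `b`. -/
theorem tendsto_plancherelUp {σ ρ : YoungDiagram} {b : ℕ × ℕ} (hb : b ∉ σ.cells)
    (h : ρ.cells = insert b σ.cells) {k : ℕ} (hk : σ.rowLen k = 0) (hbk : b.1 < k) :
    Tendsto (fun z : ℝ => (z - (boxContent b : ℤ)) * σ.rowRatio k z)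
      (𝓝[≠] ((boxContent b : ℤ) : ℝ)) (𝓝 (σ.plancherelUp ρ)) := by
  obtain ⟨hb2, hrow⟩ := rowLen_of_cells_eq_insert hb h
  obtain ⟨i, j⟩ := b
  simp only at hb2 hbk hrow
  subst hb2
  have hc : ((boxContent (i, σ.rowLen i) : ℤ) : ℝ) = (σ.rowLen i : ℝ) - i := by
    simp [boxContent]
  rw [hc]
  have hik : i ∈ range (k + 1) := mem_range.2 (by omega)
  have hik' : i ∈ range k := mem_range.2 hbk
  have hden : ∀ j ∈ (range (k + 1)).erase i, (σ.rowLen i : ℝ) - i - (σ.rowLen j - j) ≠ 0 := by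
    intro j hj h0
    have h1 : ((σ.rowLen i : ℤ) : ℝ) - (i : ℤ) - ((σ.rowLen j : ℤ) - (j : ℤ)) = 0 := by
      exact_mod_cast h0
    have h2 : (σ.rowLen i : ℤ) - i - (σ.rowLen j - j) = 0 := by exact_mod_cast h1
    have hne := (mem_erase.1 hj).1
    rcases lt_or_gt_of_ne hne with hlt | hlt
    · have := σ.rowLen_antitone hlt.le
      omega
    · have := σ.rowLen_antitone hlt.le
      omega
  have hval : σ.plancherelUp ρ =
      (∏ j ∈ range k, ((σ.rowLen i : ℝ) - i - (σ.rowLen j - j) + 1)) /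
        ∏ j ∈ (range (k + 1)).erase i, ((σ.rowLen i : ℝ) - i - (σ.rowLen j - j)) := by
    rw [plancherelUp_eq hbk hk hrow, range_add_one, erase_insert_of_ne (by omega),
      prod_insert (by simp), hk, ← mul_prod_erase _ _ hik', prod_div_distrib, sub_self, zero_add,
      one_mul, Nat.cast_zero, zero_sub, sub_neg_eq_add, div_div, mul_comm]
  rw [hval]
  have hcont : ContinuousAt (fun z : ℝ => (∏ j ∈ range k, (z - ((σ.rowLen j : ℝ) - j) + 1)) /
      ∏ j ∈ (range (k + 1)).erase i, (z - ((σ.rowLen j : ℝ) - j))) ((σ.rowLen i : ℝ) - i) := by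
    refine ContinuousAt.div (by fun_prop) (by fun_prop) (prod_ne_zero_iff.2 hden)
  refine (hcont.tendsto.mono_left nhdsWithin_le_nhds).congr' ?_
  filter_upwards [self_mem_nhdsWithin] with z hz
  have hz' : z - ((σ.rowLen i : ℝ) - i) ≠ 0 := sub_ne_zero.2 hz
  rw [rowRatio, ← mul_prod_erase (range (k + 1)) _ hik, mul_div_assoc',
    mul_div_mul_left _ _ hz']

end YoungDiagram

namespace StrictPartition

theorem double_cells_of_part {mu lam : StrictPartition} {i : ℕ}
    (h : ∀ j, lam.part j = mu.part j + if j = i then 1 else 0) :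
    lam.double.cells = insert (i, i + mu.part i + 1)
      (insert (i + mu.part i, i) mu.double.cells) := by
  ext ⟨a, b⟩
  rw [mem_insert, mem_insert, mem_double_cells, mem_double_cells, h a, h b, Prod.mk.injEq,
    Prod.mk.injEq]
  by_cases ha : a = i
  · subst ha
    by_cases hb : b = a
    · subst hb
      split_ifs <;> omega
    · split_ifs <;> omega
  · by_cases hb : b = i
    · subst hb
      split_ifs <;> omega
    · simp only [if_neg ha, if_neg hb]
      omega

/-- Both sides are the limit of the same function near the content c of `b`. By part (1) it is (z -
1) times the strict rational function at v = z(z - 1), whose polar factor splits as (z - c)(z - c'),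
so a residue in v becomes a residue in z after multiplication by (c - 1)/(c - c'). -/
theorem plancherelUp_double {mu lam : StrictPartition} {i : ℕ}
    (h : ∀ j, lam.part j = mu.part j + if j = i then 1 else 0) {ρ : YoungDiagram} {b : ℕ × ℕ}
    (hb : b ∉ mu.double.cells) (hρ : ρ.cells = insert b mu.double.cells) (c' : ℝ)
    (hc : ∀ z : ℝ, z * (z - 1) - mu.part i * (mu.part i + 1) =
      (z - (boxContent b : ℤ)) * (z - c'))
    (hne : ((boxContent b : ℤ) : ℝ) - c' ≠ 0) :
    mu.double.plancherelUp ρ =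
      ((boxContent b : ℤ) - 1) * mu.plancherelUp lam / ((boxContent b : ℤ) - c') := by
  set c : ℝ := ((boxContent b : ℤ) : ℝ) with hcdef
  -- The new box may start a new row, so the rows considered must include the row of `b`.
  set k := max (mu.double.colLen 0) (b.1 + 1) with hk
  have hk0 : mu.double.rowLen k = 0 := by
    have h1 := mu.double.rowLen_antitone (le_max_left (mu.double.colLen 0) (b.1 + 1))
    rw [mu.double.rowLen_colLen_zero] at h1
    exact Nat.le_zero.1 h1
  have hbk : b.1 < k := le_max_right (mu.double.colLen 0) (b.1 + 1)
  refine tendsto_nhds_unique (YoungDiagram.tendsto_plancherelUp hb hρ hk0 hbk) ?_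
  rw [← hcdef]
  have hcv : c * (c - 1) = (mu.part i : ℝ) * (mu.part i + 1) := by
    have := hc c
    rw [sub_self, zero_mul] at this
    linarith
  have hil : i ∈ range (mu.length + 1) := by
    rw [mem_range]
    by_cases hz : mu.part i = 0
    · have := length_of_part_eq_zero h hz
      omega
    · have := length_of_part_ne_zero h hz
      omega
  have hden : ∀ j ∈ (range (mu.length + 1)).erase i,
      c * (c - 1) - (mu.part j : ℝ) * (mu.part j + 1) ≠ 0 := by
    intro j hj
    have hji := (mem_erase.1 hj).1
    have hj' := mem_range.1 (mem_erase.1 hj).2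
    have hi' := mem_range.1 hil
    have hp : mu.part i ≠ mu.part j := by
      rcases lt_or_gt_of_ne hji with hlt | hlt
      · exact (mu.part_lt_part hlt (by omega)).ne
      · exact (mu.part_lt_part hlt (by omega)).ne'
    rw [hcv, show (mu.part i : ℝ) * (mu.part i + 1) - mu.part j * (mu.part j + 1) =
      (mu.part i - mu.part j) * (mu.part i + mu.part j + 1) by ring]
    exact mul_ne_zero (sub_ne_zero.2 (Nat.cast_injective.ne hp)) (by positivity)
  have hcont : ContinuousAt (fun z : ℝ => (z - 1) *
      ((∏ j ∈ range mu.length, (z * (z - 1) - (mu.part j : ℝ) * (mu.part j - 1))) /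
        ∏ j ∈ (range (mu.length + 1)).erase i,
          (z * (z - 1) - (mu.part j : ℝ) * (mu.part j + 1))) / (z - c')) c := by
    refine ContinuousAt.div (ContinuousAt.mul (by fun_prop) (ContinuousAt.div (by fun_prop)
      (by fun_prop) (prod_ne_zero_iff.2 hden))) (by fun_prop) hne
  rw [plancherelUp_eq h, ← hcv]
  refine (hcont.tendsto.mono_left nhdsWithin_le_nhds).congr' ?_
  filter_upwards [self_mem_nhdsWithin, eventually_ne_intCast (boxContent b)] with z hz hzint
  have hz' : z - c ≠ 0 := sub_ne_zero.2 hz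
  rw [← rowRatio_double hzint mu k hk0, rowRatio, ← mul_prod_erase (range (mu.length + 1)) _ hil,
    hc z]
  generalize (∏ j ∈ range mu.length, (z * (z - 1) - (mu.part j : ℝ) * (mu.part j - 1))) = A
  generalize (∏ j ∈ (range (mu.length + 1)).erase i,
          (z * (z - 1) - (mu.part j : ℝ) * (mu.part j + 1))) = B
  field_simp

end StrictPartition

/-! ### Conclusion -/

theorem mainTheorem2 :
    (∀ lam : StrictPartition,
      (RatFunc.X - 1) *
          RatFunc.eval (RatFunc.C : ℂ →+* RatFunc ℂ) (RatFunc.X * (RatFunc.X - 1)) lam.kerovR =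
        lam.double.kerovR) ∧
    ∀ mu lam : StrictPartition, mu.Covers lam →
      (lam.length = mu.length →
        ∃ ρa ρb : YoungDiagram, ρa ≠ ρb ∧
          (∀ ρ : YoungDiagram,
            (mu.double.Covers ρ ∧ ρ.Covers lam.double) ↔ (ρ = ρa ∨ ρ = ρb)) ∧
          mu.plancherelUp lam =
            mu.double.plancherelUp ρa + mu.double.plancherelUp ρb) ∧
      (lam.length ≠ mu.length →
        lam.length = mu.length + 1 ∧
        ∃ ρ₀ : YoungDiagram,
          (∀ ρ : YoungDiagram,
            (mu.double.Covers ρ ∧ ρ.Covers lam.double) ↔ ρ = ρ₀) ∧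
          mu.plancherelUp lam = mu.double.plancherelUp ρ₀) := by
  refine ⟨StrictPartition.double_kerovR, fun mu lam hcov => ?_⟩
  obtain ⟨i, h⟩ := hcov.exists_part
  have hcells := StrictPartition.double_cells_of_part h
  set b : ℕ × ℕ := (i, i + mu.part i + 1) with hbdef
  set b' : ℕ × ℕ := (i + mu.part i, i) with hbdef'
  have hb : b ∉ mu.double.cells := by
    rw [hbdef, StrictPartition.mem_double_cells]
    omega
  have hb' : b' ∉ mu.double.cells := by
    rw [hbdef', StrictPartition.mem_double_cells]
    by_cases hm : mu.part i = 0
    · rw [hm]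
      omega
    · omega
  have hne : b ≠ b' := by
    rw [hbdef, hbdef', Ne, Prod.mk.injEq]
    omega
  have hle' : ¬ b ≤ b' := by
    rw [hbdef, hbdef', Prod.mk_le_mk]
    omega
  have hiff := YoungDiagram.covers_and_covers_iff hcells hb hb' hne
  -- The box `b'` in the lower half can always be added first; whether `b` can depends on whether
  -- μ_i = 0.
  obtain ⟨ρb, hρb⟩ := YoungDiagram.exists_cells_eq_insert (σ := mu.double) (b := b') (b' := b)
    (by rw [hcells, Finset.insert_comm]) hle'
  have hcb : ((boxContent b : ℤ) : ℝ) = mu.part i + 1 := by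
    simp only [hbdef, boxContent]
    push_cast
    ring
  have hcb' : ((boxContent b' : ℤ) : ℝ) = -mu.part i := by
    simp only [hbdef', boxContent]
    push_cast
    ring
  have hpos : (mu.part i : ℝ) + mu.part i + 1 ≠ 0 := by positivity
  have hpb := StrictPartition.plancherelUp_double h hb' hρb (mu.part i + 1)
    (fun z => by rw [hcb']; ring)
    (by rw [hcb']; intro h0; apply hpos; linear_combination -h0)
  rw [hcb'] at hpb
  by_cases hm : mu.part i = 0
  · obtain ⟨_, hlen⟩ := StrictPartition.length_of_part_eq_zero h hm
    refine ⟨fun hl => by omega, fun _ => ⟨hlen, ρb, fun ρ => (hiff ρ).trans ?_, ?_⟩⟩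
    · constructor
      · rintro (h1 | h1)
        · exfalso
          -- For μ_i = 0 the box `b'` is the diagonal box immediately left of `b`, so `b` alone does
          -- not give a diagram.
          have hle : b' ≤ b := by
            rw [hbdef, hbdef', Prod.mk_le_mk]
            omega
          have h2 : b' ∈ ρ.cells := ρ.isLowerSet hle (h1 ▸ Finset.mem_insert_self _ _)
          rw [h1, Finset.mem_insert] at h2
          exact h2.elim (fun e => hne e.symm) hb'
        · exact YoungDiagram.ext (h1.trans hρb.symm)
      · rintro rfl
        exact Or.inr hρb
    · rw [hpb, hm]
      norm_num
  · obtain ⟨_, hlen⟩ := StrictPartition.length_of_part_ne_zero h hm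
    have hle : ¬ b' ≤ b := by
      rw [hbdef, hbdef', Prod.mk_le_mk]
      omega
    obtain ⟨ρa, hρa⟩ := YoungDiagram.exists_cells_eq_insert (b := b) (b' := b') hcells hle
    have hpa := StrictPartition.plancherelUp_double h hb hρa (-mu.part i)
      (fun z => by rw [hcb]; ring)
      (by rw [hcb]; intro h0; apply hpos; linear_combination h0)
    rw [hcb] at hpa
    refine ⟨fun _ => ⟨ρa, ρb, ?_, fun ρ => (hiff ρ).trans ?_, ?_⟩, fun hl => absurd hlen hl⟩
    · rintro rfl
      have h2 : b ∈ insert b' mu.double.cells := by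
        rw [← hρb, hρa]
        exact Finset.mem_insert_self _ _
      rw [Finset.mem_insert] at h2
      exact h2.elim hne hb
    · constructor
      · rintro (h1 | h1)
        · exact Or.inl (YoungDiagram.ext (h1.trans hρa.symm))
        · exact Or.inr (YoungDiagram.ext (h1.trans hρb.symm))
      · rintro (rfl | rfl)
        · exact Or.inl hρa
        · exact Or.inr hρb
    -- With m = μ_i the weights are m/(2m + 1) and (-m - 1)/(-(2m + 1)), whose sum is 1.
    · have e1 : (mu.part i : ℝ) + 1 - -mu.part i = mu.part i + mu.part i + 1 := by ring
      have e2 : -(mu.part i : ℝ) - (mu.part i + 1) = -(mu.part i + mu.part i + 1) := by ring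
      rw [hpa, hpb, e1, e2]
      field_simp
      ring
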